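/- Say that a group $\Gamma$ has property FSI if every isometric action of $\Gamma$ on a Riemannian symmetric space without compact factors (Euclidean spaces are allowed), and every isometric action of $\Gamma$ on the Euclidean (Bruhat–Tits) building of $SL(n,K)$, for any $n$ and any non-archimedean local field $K$, has a fixed point. Say that $\Gamma$ has finite representation type if every finite-dimensional complex linear representation of $\Gamma$, i.e. every homomorphism $h:\Gamma\to GL(n,\mathbf{C})$ with $n\ge 0$, has finite image. Let $\Gamma$ be a finitely generated group. If $\Gamma$ has property FSI, then $\Gamma$ has finite representation type. -/

import Mathlib

open scoped Manifold ContDiff Topology Bundle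

noncomputable section

/-- The metric space `X` is a (finite-dimensional, smooth, connected, nonempty) Riemannian manifold
with its Riemannian distance. Connectedness is automatic, since the infimum of the lengths of
the `C^1` paths between two points is the finite number `dist x y`. -/
def IsMetricOfRiemannianManifold (X : Type) [MetricSpace X] : Prop :=
  Nonempty X ∧
    ∃ (E : Type) (_ : NormedAddCommGroup E) (_ : NormedSpace ℝ E) (_ : FiniteDimensional ℝ E)
      (_ : ChartedSpace E X) (_ : IsManifold 𝓘(ℝ, E) ∞ X)
      (_ : Bundle.RiemannianBundle (fun x : X => TangentSpace 𝓘(ℝ, E) x)),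
      IsContMDiffRiemannianBundle 𝓘(ℝ, E) ∞ E (fun x : X => TangentSpace 𝓘(ℝ, E) x) ∧
        IsRiemannianManifold 𝓘(ℝ, E) X

/-- Riemannian symmetric spaces: every point is an isolated fixed point of an involutive isometry
(which is then the geodesic symmetry at that point). Euclidean spaces are included. -/
def IsRiemannianSymmetricSpace (X : Type) [MetricSpace X] : Prop :=
  IsMetricOfRiemannianManifold X ∧
    ∀ x : X, ∃ s : X ≃ᵢ X, s x = x ∧ (∀ y, s (s y) = y) ∧ ∀ᶠ y in 𝓝 x, s y = y → y = x

/-- `X` has no compact factor: in every decomposition of `X` as a product, with the product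
distance `√(d_Y ^ 2 + d_Z ^ 2)` (the distance of a Riemannian product), a compact factor `Z` is
reduced to a point. (Factors embed isometrically in `X`, so it is enough to consider those
in `Type`.) -/
def HasNoCompactFactor (X : Type) [MetricSpace X] : Prop :=
  ∀ (Y Z : Type) [MetricSpace Y] [MetricSpace Z] [CompactSpace Z],
    Nonempty (X ≃ᵢ WithLp 2 (Y × Z)) → Subsingleton Z

section Building

variable {n : ℕ} {K : Type} [NontriviallyNormedField K]

/-- Ultrametric norms on the vector space `K ^ n` over the valued field `K`. -/
structure IsUltrametricNorm (N : (Fin n → K) → ℝ) : Prop where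
  eq_zero_iff : ∀ x, N x = 0 ↔ x = 0
  smul : ∀ (c : K) (x : Fin n → K), N (c • x) = ‖c‖ * N x
  add_le_max : ∀ x y, N (x + y) ≤ max (N x) (N y)

/-- The basis `b` is adapted to (splits) the norm `N`: if `x = ∑ c i • b i`, then `N x` is the
largest of the numbers `‖c i‖ * N (b i)`. -/
def IsAdaptedBasis (b : Module.Basis (Fin n) K (Fin n → K)) (N : (Fin n → K) → ℝ) : Prop :=
  ∀ x, N x = ⨆ i, ‖b.repr x i‖ * N (b i)

end Building

/-- The Euclidean (Bruhat-Tits) building of `SL(n)` over the valued field `K`, in the model of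
Goldman-Iwahori and Bruhat-Tits: its points are the splittable ultrametric norms on `K ^ n`,
normalised to have volume one (each homothety class of norms contains exactly one such norm).
The apartment of a frame of `K ^ n` consists of the norms to which a basis directed by the frame
is adapted; the vertices correspond to the homothety classes of lattices. -/
@[ext]
structure BuildingSL (n : ℕ) (K : Type) [NontriviallyNormedField K] where
  /-- the norm -/
  norm : (Fin n → K) → ℝ
  isUltrametricNorm : IsUltrametricNorm norm
  exists_isAdaptedBasis : ∃ b : Module.Basis (Fin n) K (Fin n → K), IsAdaptedBasis b norm ∧
    ∏ i, norm (b i) = ‖(Pi.basisFun K (Fin n)).det b‖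

/-- The distance of the building (over a non-archimedean local field `K`). Two points `N`, `N'` lie in a common apartment, i.e. have
a common adapted basis `b`, and their distance is the Euclidean norm of the vector of
the `log (N' (b i) / N (b i))`. This number does not depend on the choice of `b`, so that the set
below has exactly one element. -/
def BuildingSL.distance {n : ℕ} {K : Type} [NontriviallyNormedField K]
    (N N' : BuildingSL n K) : ℝ :=
  sInf {r : ℝ | ∃ b : Module.Basis (Fin n) K (Fin n → K),
    IsAdaptedBasis b N.norm ∧ IsAdaptedBasis b N'.norm ∧
      r = √(∑ i, Real.log (N'.norm (b i) / N.norm (b i)) ^ 2)}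

/-- Property FSI: every isometric action of `Γ` on a symmetric space without compact factors, and
every isometric action of `Γ` on a Euclidean building of `SL(n)` over a non-archimedean local field
(a locally compact, non-discrete field with an ultrametric absolute value), has a fixed point.
(All these spaces have at most the cardinality of the continuum, hence have copies in `Type`.) -/
def PropertyFSI (Γ : Type*) [Group Γ] : Prop :=
  (∀ (X : Type) [MetricSpace X], IsRiemannianSymmetricSpace X → HasNoCompactFactor X →
    ∀ α : Γ →* (X ≃ᵢ X), ∃ x : X, ∀ g : Γ, α g x = x) ∧
  (∀ (n : ℕ) (K : Type) [NontriviallyNormedField K] [IsUltrametricDist K] [LocallyCompactSpace K],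
    ∀ α : Γ →* Equiv.Perm (BuildingSL n K),
      (∀ (g : Γ) (N N' : BuildingSL n K),
        BuildingSL.distance (α g N) (α g N') = BuildingSL.distance N N') →
      ∃ N : BuildingSL n K, ∀ g : Γ, α g N = N)

/-- Finite representation type: every finite-dimensional (complex) linear representation has
finite image. -/
def FiniteRepresentationType (Γ : Type*) [Group Γ] : Prop :=
  ∀ (n : ℕ) (h : Γ →* Matrix.GeneralLinearGroup (Fin n) ℂ), (Set.range h).Finite

end

/-!
Property FSI is used for two families of spaces: the symmetric spaces `GL(m, ℝ) / O(m)` and the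
buildings of `SL(n, ℚ_p)`.

The group `GL(m, ℝ)` acts by congruences `p ↦ A p Aᵀ` on the space `PosDefMatrix m` of positive
definite matrices with the Riemannian metric `tr (p⁻¹ u p⁻¹ v)`. This is a symmetric space with
the symmetries `p ↦ q p⁻¹ q`. The distance from the identity to `diag (exp (a i))` is the Euclidean
norm of `a`: it is bounded above by the obvious path, and below by functions built from the
leading minors, which are contracting (`PosDefMatrix.edist_iwasawaLog_le`). Any two points lie on
a translate of this flat, so that `d(p, s_q p) = 2 d(p, q)` for all `p`, `q`, and this prevents
compact factors: apply it to points that realise the diameter of the factor. A fixed point of the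
action of `Γ` through a real representation is an invariant scalar product. Hence traces are
bounded by the dimension, and the image is finite as soon as the set of traces is
(`PropertyFSI.finite_range_of_finite_trace`), because traces compute the distances between
orthogonal matrices.

For a local field `K`, a fixed point of `Γ` in the building is an invariant ultrametric norm with an
adapted basis (the determinant has absolute value one, since `Γ` has no homomorphisms to the
positive reals). In that basis the diagonal entries of the matrices are integral, so traces are
integral (`PropertyFSI.norm_trace_le_one`).

The rest is algebra. The traces of a rational representation are integers and bounded, so its image
is finite (`PropertyFSI.finite_range_rat`). The traces of a complex representation `ρ` are
algebraic, since a transcendental trace could be made arbitrarily large by an endomorphism of the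
field `ℂ`, whereas restriction of scalars to `ℝ` bounds its real part. As `Γ` is finitely
generated, `ρ` is defined over a finitely generated `ℚ`-algebra `A`. Modulo a maximal ideal of `A`
one gets a representation over a number field, thus a rational one by restriction of scalars, and
its image is finite. Algebraic elements of `A` are determined by their residues, hence `ρ` has
finitely many traces and, viewed as a real representation, finite image.
-/

/-! ### Maps that contract Riemannian metrics contract distances -/

section RiemannianLipschitz

open Set MeasureTheory
open scoped ENNReal

variable {E E' : Type*} [NormedAddCommGroup E] [NormedSpace ℝ E]
  [NormedAddCommGroup E'] [NormedSpace ℝ E']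
  {H H' : Type*} [TopologicalSpace H] [TopologicalSpace H']
  {I : ModelWithCorners ℝ E H} {I' : ModelWithCorners ℝ E' H'}
  {M M' : Type*} [TopologicalSpace M] [ChartedSpace H M]
  [TopologicalSpace M'] [ChartedSpace H' M']
  [Bundle.RiemannianBundle (fun x : M => TangentSpace I x)]
  [Bundle.RiemannianBundle (fun x : M' => TangentSpace I' x)]

/-- A map whose derivative does not increase norms does not increase Riemannian distances, since it
does not increase the lengths of paths. -/
theorem riemannianEDist_map_le {Φ : M → M'} (hΦ : ContMDiff I I' 1 Φ)
    (h : ∀ x (v : TangentSpace I x), ‖mfderiv I I' Φ x v‖ ≤ ‖v‖) (x y : M) :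
    Manifold.riemannianEDist I' (Φ x) (Φ y) ≤ Manifold.riemannianEDist I x y := by
  refine le_of_forall_gt fun r hr => ?_
  obtain ⟨γ, h0, h1, hγ, hlen⟩ := Manifold.exists_lt_of_riemannianEDist_lt hr
  refine lt_of_le_of_lt ?_ hlen
  refine (Manifold.riemannianEDist_le_pathELength (γ := Φ ∘ γ) (a := 0) (b := 1)
    (hΦ.comp_contMDiffOn hγ) (by simp [h0]) (by simp [h1]) zero_le_one).trans ?_
  rw [Manifold.pathELength_eq_lintegral_mfderivWithin_Icc,
    Manifold.pathELength_eq_lintegral_mfderivWithin_Icc]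
  refine setLIntegral_mono' measurableSet_Icc fun t ht => ?_
  have hu : UniqueMDiffWithinAt 𝓘(ℝ, ℝ) (Icc (0 : ℝ) 1) t := by
    rw [uniqueMDiffWithinAt_iff_uniqueDiffWithinAt]
    exact uniqueDiffOn_Icc zero_lt_one _ ht
  have key := mfderiv_comp_mfderivWithin (I := 𝓘(ℝ, ℝ)) (I' := I) (I'' := I') (s := Icc (0 : ℝ) 1)
    t (g := Φ) (f := γ)
    (hΦ.mdifferentiable one_ne_zero _) (hγ.mdifferentiableOn one_ne_zero t ht) hu
  rw [key]
  have := h (γ t) (mfderivWithin 𝓘(ℝ, ℝ) I γ (Icc (0 : ℝ) 1) t 1)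
  rw [← ofReal_norm, ← ofReal_norm]
  exact ENNReal.ofReal_le_ofReal this

end RiemannianLipschitz

/-! ### The manifold of positive definite matrices -/

noncomputable section

open Topology Matrix

attribute [local instance] Matrix.linftyOpNormedRing Matrix.linftyOpNormedAlgebra

/-- The symmetric matrices, as a subspace of the matrices. -/
def symSubmodule (m : ℕ) : Submodule ℝ (Matrix (Fin m) (Fin m) ℝ) where
  carrier := {A | A.IsSymm}
  add_mem' := fun ha hb => Matrix.IsSymm.add ha hb
  zero_mem' := Matrix.isSymm_zero
  smul_mem' := fun c _ ha => Matrix.IsSymm.smul ha c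

/-- The vector space of real symmetric `m × m` matrices. It is normed by the operator norm of
matrices for the sup norm of `ℝ ^ m`; the choice of the norm does not matter. -/
def SymMatrix (m : ℕ) : Type := symSubmodule m

namespace SymMatrix

variable {m : ℕ}

instance : NormedAddCommGroup (SymMatrix m) := inferInstanceAs (NormedAddCommGroup (symSubmodule m))
instance : NormedSpace ℝ (SymMatrix m) := inferInstanceAs (NormedSpace ℝ (symSubmodule m))
instance : FiniteDimensional ℝ (SymMatrix m) :=
  inferInstanceAs (FiniteDimensional ℝ (symSubmodule m))

/-- The inclusion of the symmetric matrices in the matrices. -/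
def toMatrix : SymMatrix m →ₗ[ℝ] Matrix (Fin m) (Fin m) ℝ := (symSubmodule m).subtype

/-- A symmetric matrix, as an element of `SymMatrix`. -/
def mk (A : Matrix (Fin m) (Fin m) ℝ) (hA : A.IsSymm) : SymMatrix m := ⟨A, hA⟩

@[simp] theorem toMatrix_mk (A : Matrix (Fin m) (Fin m) ℝ) (hA : A.IsSymm) :
    toMatrix (mk A hA) = A := rfl

theorem isSymm (A : SymMatrix m) : A.toMatrix.IsSymm := A.2

theorem toMatrix_injective : Function.Injective (toMatrix : SymMatrix m → _) :=
  Subtype.val_injective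

end SymMatrix

theorem LinearMap.contDiff_of_finiteDimensional {E F : Type*} [NormedAddCommGroup E]
    [NormedSpace ℝ E] [FiniteDimensional ℝ E] [NormedAddCommGroup F] [NormedSpace ℝ F]
    {n : WithTop ℕ∞} (f : E →ₗ[ℝ] F) : ContDiff ℝ n f :=
  f.toContinuousLinearMap.contDiff

/-- The space of positive definite real symmetric `m × m` matrices. It is a type of its own, rather
than a subtype, because its distance is not that of the ambient vector space. -/
@[ext]
structure PosDefMatrix (m : ℕ) : Type where
  /-- the underlying symmetric matrix -/
  val : SymMatrix m
  posDef : val.toMatrix.PosDef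

namespace PosDefMatrix

variable {m : ℕ}

/-- Positivity needs to be tested on the unit sphere only, which is compact. -/
theorem isOpen_posDef : IsOpen {A : SymMatrix m | A.toMatrix.PosDef} := by
  have hK : IsCompact (Metric.sphere (0 : Fin m → ℝ) 1) := isCompact_sphere _ _
  have hcont : Continuous fun z : SymMatrix m × (Fin m → ℝ) =>
      z.2 ⬝ᵥ (z.1.toMatrix *ᵥ z.2) := by
    have h : Continuous (SymMatrix.toMatrix : SymMatrix m → Matrix (Fin m) (Fin m) ℝ) :=
      SymMatrix.toMatrix.continuous_of_finiteDimensional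
    fun_prop
  have heq : {A : SymMatrix m | A.toMatrix.PosDef} =
      {A | ∀ x ∈ Metric.sphere (0 : Fin m → ℝ) 1,
        0 < x ⬝ᵥ (A.toMatrix *ᵥ x)} := by
    ext A
    constructor
    · intro hA x hx
      have : x ≠ 0 := by
        rintro rfl
        simp at hx
      simpa using Matrix.PosDef.dotProduct_mulVec_pos hA this
    · intro hA
      refine Matrix.PosDef.of_dotProduct_mulVec_pos ?_ fun {x} hx => ?_
      · have : A.toMatrix.IsSymm := A.2
        simpa [Matrix.IsHermitian, Matrix.conjTranspose_eq_transpose_of_trivial] using this.eq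
      · have hn : 0 < ‖x‖ := norm_pos_iff.2 hx
        have := hA (‖x‖⁻¹ • x) (by simp [norm_smul, hn.ne'])
        rw [mulVec_smul, dotProduct_smul, smul_dotProduct, smul_eq_mul, smul_eq_mul] at this
        have h2 := (mul_pos_iff_of_pos_left (inv_pos.2 hn)).1 this
        simpa using (mul_pos_iff_of_pos_left (inv_pos.2 hn)).1 h2
  rw [heq]
  rw [isOpen_iff_eventually]
  intro A hA
  refine hK.eventually_forall_of_forall_eventually fun x hx => ?_
  exact hcont.continuousAt.eventually (lt_mem_nhds (hA x hx))

instance : TopologicalSpace (PosDefMatrix m) := TopologicalSpace.induced val inferInstance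

theorem val_injective : Function.Injective (val : PosDefMatrix m → SymMatrix m) :=
  fun _ _ h => PosDefMatrix.ext h

theorem range_val : Set.range (val : PosDefMatrix m → SymMatrix m) =
    {A : SymMatrix m | A.toMatrix.PosDef} := by
  ext A
  exact ⟨by rintro ⟨p, rfl⟩; exact p.posDef, fun h => ⟨⟨A, h⟩, rfl⟩⟩

theorem isOpenEmbedding_val : IsOpenEmbedding (val : PosDefMatrix m → SymMatrix m) :=
  ⟨⟨⟨rfl⟩, val_injective⟩, by rw [range_val]; exact isOpen_posDef⟩

instance : Nonempty (PosDefMatrix m) := ⟨⟨.mk 1 Matrix.isSymm_one, Matrix.PosDef.one⟩⟩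

instance : ChartedSpace (SymMatrix m) (PosDefMatrix m) :=
  isOpenEmbedding_val.singletonChartedSpace

instance : IsManifold 𝓘(ℝ, SymMatrix m) ∞ (PosDefMatrix m) :=
  isOpenEmbedding_val.isManifold_singleton

instance : T3Space (PosDefMatrix m) := isOpenEmbedding_val.isEmbedding.t3Space

theorem contMDiff_val {n : WithTop ℕ∞} :
    ContMDiff 𝓘(ℝ, SymMatrix m) 𝓘(ℝ, SymMatrix m) n (val : PosDefMatrix m → SymMatrix m) :=
  contMDiff_isOpenEmbedding isOpenEmbedding_val

/-- In the single chart `val`, every tangent space is the model space, and `val` has derivative the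
identity. -/
theorem mfderiv_val (p : PosDefMatrix m) (v : TangentSpace 𝓘(ℝ, SymMatrix m) p) :
    mfderiv 𝓘(ℝ, SymMatrix m) 𝓘(ℝ, SymMatrix m) (val : PosDefMatrix m → SymMatrix m) p v =
      (v : SymMatrix m) := by
  have h := TangentBundle.continuousLinearMapAt_trivializationAt (I := 𝓘(ℝ, SymMatrix m))
    (x₀ := p) (x := p) (mem_chart_source _ _)
  have h2 : (extChartAt 𝓘(ℝ, SymMatrix m) p : PosDefMatrix m → SymMatrix m) = val := rfl
  rw [h2] at h
  rw [← h, TangentBundle.continuousLinearMapAt_trivializationAt_eq_core (mem_chart_source _ _)]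
  exact (tangentBundleCore 𝓘(ℝ, SymMatrix m) (PosDefMatrix m)).coordChange_self
    (achart (SymMatrix m) p) p (mem_chart_source _ p) v

/-- The bilinear form `(u, v) ↦ tr (B u B v)` on symmetric matrices. -/
def traceForm (B : Matrix (Fin m) (Fin m) ℝ) : SymMatrix m →L[ℝ] SymMatrix m →L[ℝ] ℝ :=
  (LinearMap.mk₂ ℝ (fun u v : SymMatrix m => trace (B * u.toMatrix * B * v.toMatrix))
    (by intros; simp [mul_add, add_mul]) (by intros; simp)
    (by intros; simp [mul_add]) (by intros; simp)).toContinuousBilinearMap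

theorem traceForm_apply (B : Matrix (Fin m) (Fin m) ℝ) (u v : SymMatrix m) :
    traceForm B u v = trace (B * u.toMatrix * B * v.toMatrix) := rfl

theorem contDiffAt_inv (p : PosDefMatrix m) :
    ContDiffAt ℝ ∞ (fun A : SymMatrix m => A.toMatrix⁻¹) p.val := by
  obtain ⟨U, hU⟩ := p.posDef.isUnit
  have h1 : ContDiffAt ℝ ∞ (Ring.inverse : Matrix (Fin m) (Fin m) ℝ → _) (p.val.toMatrix) := by
    rw [← hU]; exact contDiffAt_ringInverse ℝ U
  have h2 : ContDiffAt ℝ ∞ (fun A : SymMatrix m => A.toMatrix) p.val :=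
    SymMatrix.toMatrix.contDiff_of_finiteDimensional.contDiffAt
  simp only [Matrix.nonsing_inv_eq_ringInverse]
  exact h1.comp p.val h2

theorem contDiffAt_traceForm_inv (p : PosDefMatrix m) :
    ContDiffAt ℝ ∞ (fun A : SymMatrix m => traceForm (A.toMatrix⁻¹)) p.val := by
  have hopen := isOpen_posDef (m := m)
  refine ContDiffOn.contDiffAt (s := {A : SymMatrix m | A.toMatrix.PosDef}) ?_
    (hopen.mem_nhds p.posDef)
  refine contDiffOn_clm_apply.2 fun u => contDiffOn_clm_apply.2 fun v => ?_
  simp only [traceForm_apply]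
  intro A hA
  have hinv := contDiffAt_inv ⟨A, hA⟩
  have ht : ContDiff ℝ ∞ (fun A : Matrix (Fin m) (Fin m) ℝ => trace A) :=
    (Matrix.traceLinearMap (Fin m) ℝ ℝ).contDiff_of_finiteDimensional
  exact (ht.contDiffAt.comp A
    (((hinv.mul contDiffAt_const).mul hinv).mul contDiffAt_const)).contDiffWithinAt

theorem traceForm_comm (B : Matrix (Fin m) (Fin m) ℝ) (u v : SymMatrix m) :
    traceForm B u v = traceForm B v u := by
  rw [traceForm_apply, traceForm_apply, Matrix.mul_assoc, Matrix.trace_mul_comm,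
    Matrix.mul_assoc, Matrix.mul_assoc, Matrix.mul_assoc]

/-- Invariance of the trace form. It is applied with `C = A⁻ᵀ` and `D = A⁻¹` to the congruence
`p ↦ A p Aᵀ`, whose inverse matrices transform by `B ↦ C B D`. -/
theorem traceForm_conj {B : Matrix (Fin m) (Fin m) ℝ} (C D : Matrix (Fin m) (Fin m) ℝ)
    (u v : SymMatrix m) (u' v' : SymMatrix m) (hu : D * u'.toMatrix * C = u.toMatrix)
    (hv : D * v'.toMatrix * C = v.toMatrix) :
    traceForm (C * B * D) u' v' = traceForm B u v := by
  rw [traceForm_apply, traceForm_apply, ← hu, ← hv]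
  simp only [Matrix.mul_assoc]
  rw [Matrix.trace_mul_comm]
  simp only [Matrix.mul_assoc]

theorem traceForm_self_eq_sum (d : Fin m → ℝ) (u : SymMatrix m) :
    traceForm (diagonal d) u u = ∑ i, ∑ j, d i * d j * u.toMatrix i j ^ 2 := by
  rw [traceForm_apply, Matrix.mul_assoc, Matrix.trace]
  refine Finset.sum_congr rfl fun i _ => ?_
  rw [diag_apply, Matrix.mul_apply]
  refine Finset.sum_congr rfl fun j _ => ?_
  rw [diagonal_mul, diagonal_mul, u.isSymm.apply]
  ring

end PosDefMatrix

/-! ### The invariant Riemannian metric -/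

namespace SymMatrix

variable {m : ℕ}

/-- The congruence `u ↦ A u Aᵀ`. -/
def congr (A : Matrix (Fin m) (Fin m) ℝ) : SymMatrix m →ₗ[ℝ] SymMatrix m where
  toFun u := mk (A * u.toMatrix * Aᵀ) (by
    rw [Matrix.IsSymm]; simp [Matrix.transpose_mul, u.isSymm.eq, Matrix.mul_assoc])
  map_add' u v := toMatrix_injective (by
    rw [toMatrix_mk, map_add, map_add, toMatrix_mk, toMatrix_mk, mul_add, add_mul])
  map_smul' c u := toMatrix_injective (by
    rw [toMatrix_mk, map_smul, RingHom.id_apply, map_smul, toMatrix_mk, Matrix.mul_smul,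
      Matrix.smul_mul])

@[simp] theorem toMatrix_congr (A : Matrix (Fin m) (Fin m) ℝ) (u : SymMatrix m) :
    (congr A u).toMatrix = A * u.toMatrix * Aᵀ := rfl

theorem congr_mul (A B : Matrix (Fin m) (Fin m) ℝ) (u : SymMatrix m) :
    congr (A * B) u = congr A (congr B u) :=
  toMatrix_injective (by simp [Matrix.mul_assoc])

theorem congr_one (u : SymMatrix m) : congr 1 u = u :=
  toMatrix_injective (by simp)

theorem congr_injective {A : Matrix (Fin m) (Fin m) ℝ} (hA : IsUnit A) :
    Function.Injective (congr A) := by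
  have h : A⁻¹ * A = 1 := Matrix.nonsing_inv_mul A ((Matrix.isUnit_iff_isUnit_det A).1 hA)
  intro u v huv
  have := congrArg (congr A⁻¹) huv
  rwa [← congr_mul, ← congr_mul, h, congr_one, congr_one] at this

end SymMatrix

theorem Matrix.PosDef.exists_lower_conj_eq_diagonal {m : ℕ} {S : Matrix (Fin m) (Fin m) ℝ}
    (hS : S.PosDef) :
    ∃ (L : Matrix (Fin m) (Fin m) ℝ) (d : Fin m → ℝ), IsUnit L ∧ (∀ i j, i < j → L i j = 0) ∧
      (∀ i, 0 < d i) ∧ L * S * Lᵀ = diagonal d := by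
  have hL : IsUnit (LDL.lowerInv hS) := isUnit_of_invertible _
  have hd : LDL.lowerInv hS * S * (LDL.lowerInv hS)ᵀ = diagonal (LDL.diagEntries hS) := by
    rw [← conjTranspose_eq_transpose_of_trivial, ← LDL.diag_eq_lowerInv_conj]
    rfl
  refine ⟨LDL.lowerInv hS, LDL.diagEntries hS, hL, fun i j => LDL.lowerInv_triangular hS, ?_, hd⟩
  rw [← Matrix.posDef_diagonal_iff, ← hd, ← conjTranspose_eq_transpose_of_trivial]
  exact (Matrix.IsUnit.posDef_star_right_conjugate_iff hL).2 hS

namespace PosDefMatrix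

variable {m : ℕ}

theorem traceForm_congr {A : Matrix (Fin m) (Fin m) ℝ} (hA : IsUnit A)
    (B : Matrix (Fin m) (Fin m) ℝ) (u v : SymMatrix m) :
    traceForm (A * B * Aᵀ)⁻¹ (u.congr A) (v.congr A) = traceForm B⁻¹ u v := by
  have hd := (Matrix.isUnit_iff_isUnit_det A).1 hA
  have h1 : A⁻¹ * A = 1 := Matrix.nonsing_inv_mul A hd
  have h2 : Aᵀ * Aᵀ⁻¹ = 1 := Matrix.mul_nonsing_inv _ (by rwa [det_transpose])
  have key : ∀ w : SymMatrix m, A⁻¹ * (w.congr A).toMatrix * Aᵀ⁻¹ = w.toMatrix := fun w => by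
    rw [SymMatrix.toMatrix_congr, Matrix.mul_assoc, Matrix.mul_assoc (A * _), h2, Matrix.mul_one,
      ← Matrix.mul_assoc, h1, Matrix.one_mul]
  have := traceForm_conj (B := B⁻¹) Aᵀ⁻¹ A⁻¹ u v _ _ (key u) (key v)
  rwa [Matrix.mul_inv_rev, Matrix.mul_inv_rev, ← Matrix.mul_assoc]

/-- Every point of the space is congruent to a diagonal one through a lower triangular matrix,
which puts the metric in diagonal form. -/
theorem exists_traceForm_eq_sum (p : PosDefMatrix m) :
    ∃ (L : Matrix (Fin m) (Fin m) ℝ) (d : Fin m → ℝ), IsUnit L ∧ (∀ i j, i < j → L i j = 0) ∧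
      (∀ i, 0 < d i) ∧ L * p.val.toMatrix * Lᵀ = diagonal d ∧
      ∀ u : SymMatrix m, traceForm p.val.toMatrix⁻¹ u u =
        ∑ i, ∑ j, (d i)⁻¹ * (d j)⁻¹ * (u.congr L).toMatrix i j ^ 2 := by
  obtain ⟨L, d, hL, hlow, hd, h⟩ := p.posDef.exists_lower_conj_eq_diagonal
  refine ⟨L, d, hL, hlow, hd, h, fun u => ?_⟩
  rw [← traceForm_congr hL, h]
  have : (diagonal d)⁻¹ = diagonal fun i => (d i)⁻¹ := by
    refine Matrix.inv_eq_right_inv ?_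
    rw [diagonal_mul_diagonal, ← diagonal_one]
    congr 1
    ext i
    exact mul_inv_cancel₀ (hd i).ne'
  rw [this, traceForm_self_eq_sum]

theorem traceForm_pos (p : PosDefMatrix m) {u : SymMatrix m} (hu : u ≠ 0) :
    0 < traceForm p.val.toMatrix⁻¹ u u := by
  obtain ⟨L, d, hL, -, hd, -, h⟩ := p.exists_traceForm_eq_sum
  rw [h]
  have hne : (u.congr L).toMatrix ≠ 0 := fun h0 => hu <| SymMatrix.congr_injective hL <| by
    rw [map_zero]; exact SymMatrix.toMatrix_injective (by rw [h0, map_zero])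
  obtain ⟨i, j, hij⟩ : ∃ i j, (u.congr L).toMatrix i j ≠ 0 := by
    by_contra! hc
    exact hne (Matrix.ext hc)
  have hnn : ∀ i j, 0 ≤ (d i)⁻¹ * (d j)⁻¹ * (u.congr L).toMatrix i j ^ 2 := fun i j =>
    mul_nonneg (mul_pos (inv_pos.2 (hd i)) (inv_pos.2 (hd j))).le (sq_nonneg _)
  refine Finset.sum_pos' (fun i _ => Finset.sum_nonneg fun j _ => hnn i j) ⟨i, Finset.mem_univ _, ?_⟩
  refine Finset.sum_pos' (fun j _ => hnn i j) ⟨j, Finset.mem_univ _, ?_⟩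
  exact mul_pos (mul_pos (inv_pos.2 (hd i)) (inv_pos.2 (hd j))) (by positivity)

theorem isVonNBounded_traceForm (p : PosDefMatrix m) :
    Bornology.IsVonNBounded ℝ {u : SymMatrix m | traceForm p.val.toMatrix⁻¹ u u < 1} := by
  rw [NormedSpace.isVonNBounded_iff]
  have hcont : Continuous fun u : SymMatrix m => traceForm p.val.toMatrix⁻¹ u u := by fun_prop
  obtain hS | hS := (Metric.sphere (0 : SymMatrix m) 1).eq_empty_or_nonempty
  · refine (Metric.isBounded_closedBall (x := (0 : SymMatrix m)) (r := 0)).subset fun u _ => ?_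
    by_contra hu
    have hu : u ≠ 0 := by rintro rfl; simp at hu
    have : ‖u‖⁻¹ • u ∈ Metric.sphere (0 : SymMatrix m) 1 := by
      simp [norm_smul, norm_ne_zero_iff.2 hu]
    rw [hS] at this
    exact this
  obtain ⟨w, hw, hmin⟩ := (isCompact_sphere (0 : SymMatrix m) 1).exists_isMinOn hS
    hcont.continuousOn
  have hw0 : w ≠ 0 := by rintro rfl; simp at hw
  set c := traceForm p.val.toMatrix⁻¹ w w with hc
  have hcpos : 0 < c := p.traceForm_pos hw0
  refine (Metric.isBounded_closedBall (x := (0 : SymMatrix m)) (r := √(1 / c))).subset fun u hu => ?_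
  rw [mem_closedBall_zero_iff]
  refine Real.le_sqrt_of_sq_le ?_
  rw [le_div_iff₀ hcpos]
  obtain rfl | hu0 := eq_or_ne u 0
  · simp
  have hn := norm_pos_iff.2 hu0
  have h1 : c ≤ traceForm p.val.toMatrix⁻¹ (‖u‖⁻¹ • u) (‖u‖⁻¹ • u) :=
    hmin (by simp [norm_smul, hn.ne'])
  simp only [map_smul, _root_.smul_apply, smul_eq_mul] at h1
  have h2 : traceForm p.val.toMatrix⁻¹ u u < 1 := hu
  have h3 := mul_le_mul_of_nonneg_left h1 (sq_nonneg ‖u‖)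
  have h4 : ‖u‖ ^ 2 * (‖u‖⁻¹ * (‖u‖⁻¹ * traceForm p.val.toMatrix⁻¹ u u)) =
      traceForm p.val.toMatrix⁻¹ u u := by field_simp
  linarith

/-- The inner product `tr (p⁻¹ u p⁻¹ v)` on the tangent space at `p`. -/
def innerForm (p : PosDefMatrix m) :
    TangentSpace 𝓘(ℝ, SymMatrix m) p →L[ℝ] TangentSpace 𝓘(ℝ, SymMatrix m) p →L[ℝ] ℝ :=
  (traceForm p.val.toMatrix⁻¹ : SymMatrix m →L[ℝ] SymMatrix m →L[ℝ] ℝ)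

theorem trivializationAt_symm (p q : PosDefMatrix m) (v : SymMatrix m) :
    (trivializationAt (SymMatrix m) (fun p : PosDefMatrix m => TangentSpace 𝓘(ℝ, SymMatrix m) p)
      p).symm q v = (v : SymMatrix m) := by
  have h := TangentBundle.symmL_trivializationAt_eq_core (I := 𝓘(ℝ, SymMatrix m))
    (b₀ := p) (b := q) (Set.mem_univ _)
  have h2 := congrArg (fun f => f v) h
  refine Eq.trans ?_ (Eq.trans h2 ?_)
  · exact (Bundle.Trivialization.symmL_apply _ (Set.mem_univ _) _).symm
  exact (tangentBundleCore 𝓘(ℝ, SymMatrix m) (PosDefMatrix m)).coordChange_self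
    (achart (SymMatrix m) p) q (Set.mem_univ _) v

/-- The invariant Riemannian metric `tr (p⁻¹ u p⁻¹ v)` on the positive definite matrices. -/
def riemannianMetric (m : ℕ) : Bundle.ContMDiffRiemannianMetric 𝓘(ℝ, SymMatrix m) ∞ (SymMatrix m)
    (fun p : PosDefMatrix m => TangentSpace 𝓘(ℝ, SymMatrix m) p) where
  inner p := p.innerForm
  symm p u v := traceForm_comm _ _ _
  pos p u hu := p.traceForm_pos hu
  isVonNBounded p := p.isVonNBounded_traceForm
  contMDiff := by
    intro p
    rw [Bundle.contMDiffAt_section]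
    have h : ContMDiffAt 𝓘(ℝ, SymMatrix m) 𝓘(ℝ, SymMatrix m →L[ℝ] SymMatrix m →L[ℝ] ℝ) ∞
        (fun q : PosDefMatrix m => traceForm q.val.toMatrix⁻¹) p :=
      (contDiffAt_traceForm_inv p).contMDiffAt.comp p contMDiff_val.contMDiffAt
    convert! h using 1
    ext q u v
    rw [hom_trivializationAt_apply]
    refine (inCoordinates_apply_eq₂ (Set.mem_univ _) (Set.mem_univ _) (Set.mem_univ _)).trans ?_
    rw [trivializationAt_symm, trivializationAt_symm]
    simp
    rfl

instance : Bundle.RiemannianBundle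
    (fun p : PosDefMatrix m => TangentSpace 𝓘(ℝ, SymMatrix m) p) :=
  ⟨(riemannianMetric m).toRiemannianMetric⟩

instance : IsContMDiffRiemannianBundle 𝓘(ℝ, SymMatrix m) ∞ (SymMatrix m)
    (fun p : PosDefMatrix m => TangentSpace 𝓘(ℝ, SymMatrix m) p) := inferInstance

instance : IsContinuousRiemannianBundle (SymMatrix m)
    (fun p : PosDefMatrix m => TangentSpace 𝓘(ℝ, SymMatrix m) p) := by
  exact ⟨⟨(riemannianMetric m).inner, (riemannianMetric m).contMDiff.continuous,
    fun _ _ _ => rfl⟩⟩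

theorem norm_tangent_eq (p : PosDefMatrix m) (v : TangentSpace 𝓘(ℝ, SymMatrix m) p) :
    ‖v‖ = √(traceForm p.val.toMatrix⁻¹ v v) := by
  rw [norm_eq_sqrt_real_inner]
  rfl

theorem mfderiv_eq_fderiv {E : Type*} [NormedAddCommGroup E] [NormedSpace ℝ E]
    {F : SymMatrix m → E} {p : PosDefMatrix m} (hF : DifferentiableAt ℝ F p.val)
    (v : TangentSpace 𝓘(ℝ, SymMatrix m) p) :
    mfderiv 𝓘(ℝ, SymMatrix m) 𝓘(ℝ, E) (fun q : PosDefMatrix m => F q.val) p v =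
      fderiv ℝ F p.val (v : SymMatrix m) := by
  have h := mfderiv_comp_apply (I := 𝓘(ℝ, SymMatrix m)) (I' := 𝓘(ℝ, SymMatrix m))
    (I'' := 𝓘(ℝ, E)) p (g := F) (f := val) hF.mdifferentiableAt
    (contMDiff_val.mdifferentiable (n := 1) one_ne_zero p) v
  rw [mfderiv_val, _root_.mfderiv_eq_fderiv] at h
  exact h

/-- A self-map of the space of positive definite matrices that is the restriction of a
map `F` on symmetric matrices has the derivative of `F`. -/
theorem mfderiv_map_eq {F : SymMatrix m → SymMatrix m} {Φ : PosDefMatrix m → PosDefMatrix m}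
    (hΦ : ∀ q, (Φ q).val = F q.val) (hs : ContMDiff 𝓘(ℝ, SymMatrix m) 𝓘(ℝ, SymMatrix m) 1 Φ)
    {p : PosDefMatrix m} (hF : DifferentiableAt ℝ F p.val)
    (v : TangentSpace 𝓘(ℝ, SymMatrix m) p) :
    (mfderiv 𝓘(ℝ, SymMatrix m) 𝓘(ℝ, SymMatrix m) Φ p v : SymMatrix m) =
      fderiv ℝ F p.val (v : SymMatrix m) := by
  rw [← mfderiv_eq_fderiv hF]
  have h := mfderiv_comp_apply (I := 𝓘(ℝ, SymMatrix m)) (I' := 𝓘(ℝ, SymMatrix m))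
    (I'' := 𝓘(ℝ, SymMatrix m)) p (g := val) (f := Φ)
    (contMDiff_val.mdifferentiable (n := 1) one_ne_zero _)
    (hs.mdifferentiable one_ne_zero p) v
  rw [mfderiv_val] at h
  rw [← h]
  have h3 : val ∘ Φ = fun q => F q.val := funext hΦ
  rw [h3]

theorem contMDiff_of_val {F : SymMatrix m → SymMatrix m} {Φ : PosDefMatrix m → PosDefMatrix m}
    {n : WithTop ℕ∞} (hΦ : ∀ q, (Φ q).val = F q.val)
    (hF : ∀ p : PosDefMatrix m, ContDiffAt ℝ n F p.val) :
    ContMDiff 𝓘(ℝ, SymMatrix m) 𝓘(ℝ, SymMatrix m) n Φ := by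
  refine ContMDiff.of_comp_isOpenEmbedding isOpenEmbedding_val fun p => ?_
  have h : val ∘ Φ = F ∘ val := funext hΦ
  rw [h]
  exact (hF p).contMDiffAt.comp p contMDiff_val.contMDiffAt

end PosDefMatrix

/-! ### Congruences and inversion preserve the distance -/

namespace PosDefMatrix

variable {m : ℕ}

/-- The extended Riemannian distance of the invariant metric. It is used before it is known to be
finite, that is, before the metric space structure is available. -/
def rdist (p q : PosDefMatrix m) : ENNReal := Manifold.riemannianEDist 𝓘(ℝ, SymMatrix m) p q

theorem rdist_map_le {F : SymMatrix m → SymMatrix m} {Φ : PosDefMatrix m → PosDefMatrix m}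
    (hΦ : ∀ q, (Φ q).val = F q.val) (hF : ∀ p : PosDefMatrix m, ContDiffAt ℝ 1 F p.val)
    (h : ∀ (p : PosDefMatrix m) (v : SymMatrix m),
      traceForm (Φ p).val.toMatrix⁻¹ (fderiv ℝ F p.val v) (fderiv ℝ F p.val v) ≤
        traceForm p.val.toMatrix⁻¹ v v) (p q : PosDefMatrix m) :
    rdist (Φ p) (Φ q) ≤ rdist p q := by
  have hs : ContMDiff 𝓘(ℝ, SymMatrix m) 𝓘(ℝ, SymMatrix m) 1 Φ := contMDiff_of_val hΦ hF
  refine riemannianEDist_map_le hs (fun x v => ?_) p q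
  rw [norm_tangent_eq, norm_tangent_eq]
  refine Real.sqrt_le_sqrt ?_
  rw [mfderiv_map_eq hΦ hs ((hF x).differentiableAt one_ne_zero)]
  exact h x v

/-- The congruence `p ↦ A p Aᵀ` by an invertible matrix. -/
def congr (A : GL (Fin m) ℝ) (p : PosDefMatrix m) : PosDefMatrix m where
  val := p.val.congr A
  posDef := by
    rw [SymMatrix.toMatrix_congr, ← conjTranspose_eq_transpose_of_trivial]
    exact (Matrix.IsUnit.posDef_star_right_conjugate_iff A.isUnit).2 p.posDef

theorem congr_mul (A B : GL (Fin m) ℝ) (p : PosDefMatrix m) :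
    congr (A * B) p = congr A (congr B p) :=
  PosDefMatrix.ext (SymMatrix.congr_mul _ _ _)

theorem congr_one (p : PosDefMatrix m) : congr 1 p = p :=
  PosDefMatrix.ext (SymMatrix.congr_one _)

theorem rdist_congr_le (A : GL (Fin m) ℝ) (p q : PosDefMatrix m) :
    rdist (congr A p) (congr A q) ≤ rdist p q := by
  refine rdist_map_le (F := SymMatrix.congr A) (fun _ => rfl)
    (fun p => (LinearMap.contDiff_of_finiteDimensional _).contDiffAt) (fun p v => ?_) p q
  have : fderiv ℝ (SymMatrix.congr (A : Matrix (Fin m) (Fin m) ℝ)) p.val =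
      LinearMap.toContinuousLinearMap (SymMatrix.congr (A : Matrix (Fin m) (Fin m) ℝ)) :=
    (LinearMap.toContinuousLinearMap (SymMatrix.congr (A : Matrix (Fin m) (Fin m) ℝ))).fderiv
  rw [this]
  exact (traceForm_congr A.isUnit _ v v).le

theorem rdist_congr (A : GL (Fin m) ℝ) (p q : PosDefMatrix m) :
    rdist (congr A p) (congr A q) = rdist p q := by
  refine le_antisymm (rdist_congr_le A p q) ?_
  have := rdist_congr_le A⁻¹ (congr A p) (congr A q)
  rwa [← congr_mul, ← congr_mul, inv_mul_cancel, congr_one, congr_one] at this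

/-- The symmetry `p ↦ p⁻¹` at the identity. -/
def inv (p : PosDefMatrix m) : PosDefMatrix m where
  val := .mk p.val.toMatrix⁻¹ (by
    rw [Matrix.IsSymm, Matrix.transpose_nonsing_inv, p.val.isSymm.eq])
  posDef := p.posDef.inv

@[simp] theorem toMatrix_inv (p : PosDefMatrix m) : p.inv.val.toMatrix = p.val.toMatrix⁻¹ := rfl

theorem inv_mul_self (p : PosDefMatrix m) : p.val.toMatrix⁻¹ * p.val.toMatrix = 1 :=
  Matrix.nonsing_inv_mul _ ((Matrix.isUnit_iff_isUnit_det _).1 p.posDef.isUnit)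

theorem mul_inv_self (p : PosDefMatrix m) : p.val.toMatrix * p.val.toMatrix⁻¹ = 1 :=
  Matrix.mul_nonsing_inv _ ((Matrix.isUnit_iff_isUnit_det _).1 p.posDef.isUnit)

theorem inv_inv (p : PosDefMatrix m) : p.inv.inv = p :=
  PosDefMatrix.ext (SymMatrix.toMatrix_injective (by
    rw [toMatrix_inv, toMatrix_inv]
    exact Matrix.inv_eq_left_inv p.mul_inv_self))

/-- The inverse of a matrix, extended by `0` to the matrices that are not invertible. -/
def symInv (u : SymMatrix m) : SymMatrix m :=
  .mk u.toMatrix⁻¹ (by rw [Matrix.IsSymm, Matrix.transpose_nonsing_inv, u.isSymm.eq])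

theorem contDiffAt_symInv (p : PosDefMatrix m) : ContDiffAt ℝ ∞ symInv p.val := by
  obtain ⟨g, hg⟩ := LinearMap.exists_leftInverse_of_injective (SymMatrix.toMatrix (m := m))
    (LinearMap.ker_eq_bot.2 SymMatrix.toMatrix_injective)
  have h : (symInv : SymMatrix m → SymMatrix m) = fun u => g u.toMatrix⁻¹ := by
    ext1 u
    exact (congrArg (fun f => f (symInv u)) hg).symm
  rw [h]
  exact (LinearMap.contDiff_of_finiteDimensional g).contDiffAt.comp _ (contDiffAt_inv p)

theorem toMatrix_fderiv_symInv (p : PosDefMatrix m) (v : SymMatrix m) :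
    (fderiv ℝ symInv p.val v).toMatrix =
      -(p.val.toMatrix⁻¹ * v.toMatrix * p.val.toMatrix⁻¹) := by
  have hT : ∀ x : SymMatrix m, HasFDerivAt (SymMatrix.toMatrix (m := m))
      (LinearMap.toContinuousLinearMap (SymMatrix.toMatrix (m := m))) x := fun x =>
    (LinearMap.toContinuousLinearMap (SymMatrix.toMatrix (m := m))).hasFDerivAt
  have hd := ((contDiffAt_symInv p).differentiableAt (by simp)).hasFDerivAt
  have h1 := (hT (symInv p.val)).comp p.val hd
  obtain ⟨U, hU⟩ := p.posDef.isUnit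
  have h2 := hasFDerivAt_ringInverse (𝕜 := ℝ) U
  rw [hU] at h2
  have h3 := h2.comp p.val (hT p.val)
  have h4 : (SymMatrix.toMatrix ∘ symInv : SymMatrix m → _) =
      (Ring.inverse ∘ SymMatrix.toMatrix) := by
    ext1 u
    exact Matrix.nonsing_inv_eq_ringInverse _
  rw [h4] at h1
  have h5 := congrArg (fun f => f v) (h1.unique h3)
  have h6 : ((U⁻¹ : (Matrix (Fin m) (Fin m) ℝ)ˣ) : Matrix (Fin m) (Fin m) ℝ) =
    p.val.toMatrix⁻¹ := by rw [← hU, Matrix.coe_units_inv]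
  rw [← h6]
  exact h5

theorem rdist_inv_le (p q : PosDefMatrix m) : rdist p.inv q.inv ≤ rdist p q := by
  refine rdist_map_le (F := symInv) (fun _ => rfl)
    (fun p => (contDiffAt_symInv p).of_le (by simp)) (fun p v => le_of_eq ?_) p q
  rw [traceForm_apply, traceForm_apply, toMatrix_fderiv_symInv, toMatrix_inv,
    Matrix.inv_eq_left_inv p.mul_inv_self]
  have h : ∀ X : Matrix (Fin m) (Fin m) ℝ, p.val.toMatrix * (p.val.toMatrix⁻¹ * X) = X :=
    fun X => by rw [← Matrix.mul_assoc, p.mul_inv_self, Matrix.one_mul]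
  simp only [Matrix.mul_neg, Matrix.neg_mul, neg_neg, Matrix.mul_assoc, h]
  rw [Matrix.trace_mul_comm]
  simp only [Matrix.mul_assoc]

theorem rdist_inv (p q : PosDefMatrix m) : rdist p.inv q.inv = rdist p q := by
  refine le_antisymm (rdist_inv_le p q) ?_
  have := rdist_inv_le p.inv q.inv
  rwa [inv_inv, inv_inv] at this

end PosDefMatrix

/-! ### Contracting functions from leading minors -/

section LeadingMinor

variable {m : ℕ}

/-- The leading principal minor of order `k`. -/
def leadingMinor (k : ℕ) (A : Matrix (Fin m) (Fin m) ℝ) : ℝ :=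
  (A.toSquareBlockProp fun i => (i : ℕ) < k).det

theorem toSquareBlockProp_mul_of_lower {k : ℕ} {L : Matrix (Fin m) (Fin m) ℝ}
    (hL : ∀ i j, i < j → L i j = 0) (Y : Matrix (Fin m) (Fin m) ℝ) :
    (L * Y).toSquareBlockProp (fun i => (i : ℕ) < k) =
      L.toSquareBlockProp (fun i => (i : ℕ) < k) * Y.toSquareBlockProp (fun i => (i : ℕ) < k) := by
  ext ⟨i, hi⟩ ⟨j, hj⟩
  simp only [toSquareBlockProp_def, of_apply, Matrix.mul_apply]
  rw [← Finset.sum_subtype (Finset.univ.filter fun a : Fin m => (a : ℕ) < k) (by simp)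
    (fun a => L i a * Y a j)]
  refine (Finset.sum_filter_of_ne fun a _ ha => ?_).symm
  by_contra hk
  refine ha ?_
  rw [hL i a (Fin.lt_def.2 (by omega)), zero_mul]

theorem leadingMinor_conj {k : ℕ} {L : Matrix (Fin m) (Fin m) ℝ}
    (hL : ∀ i j, i < j → L i j = 0) (Y : Matrix (Fin m) (Fin m) ℝ) :
    leadingMinor k (L * Y * Lᵀ) = leadingMinor k L ^ 2 * leadingMinor k Y := by
  have h1 : ∀ Z : Matrix (Fin m) (Fin m) ℝ, leadingMinor k (L * Z) =
      leadingMinor k L * leadingMinor k Z := fun Z => by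
    rw [leadingMinor, toSquareBlockProp_mul_of_lower hL, det_mul]; rfl
  have h2 : ∀ Z : Matrix (Fin m) (Fin m) ℝ, leadingMinor k Zᵀ = leadingMinor k Z := fun Z =>
    det_transpose (Z.toSquareBlockProp fun i => (i : ℕ) < k)
  rw [Matrix.mul_assoc, h1, ← h2 (Y * Lᵀ), transpose_mul, transpose_transpose, h1, h2]
  ring

theorem leadingMinor_diagonal (k : ℕ) (d : Fin m → ℝ) :
    leadingMinor k (diagonal d) = ∏ i : {i : Fin m // (i : ℕ) < k}, d i := by
  rw [leadingMinor, ← det_diagonal]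
  congr 1
  ext i j
  simp [toSquareBlockProp_def, diagonal_apply, Subtype.ext_iff]

theorem contDiff_leadingMinor (k : ℕ) :
    ContDiff ℝ ∞ fun A : SymMatrix m => leadingMinor k A.toMatrix := by
  simp only [leadingMinor, det_apply]
  refine ContDiff.sum fun σ _ => ContDiff.const_smul _ (contDiff_prod fun i _ => ?_)
  exact ((Matrix.entryLinearMap ℝ ℝ (σ i).1 i.1).comp
    SymMatrix.toMatrix).contDiff_of_finiteDimensional

/-- Jacobi's formula for `log` of a leading minor, at a matrix that is diagonalised by a
lower triangular congruence. -/
theorem hasDerivAt_leadingMinor {k : ℕ} {L : Matrix (Fin m) (Fin m) ℝ}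
    (hlow : ∀ i j, i < j → L i j = 0) {d : Fin m → ℝ} (hd : ∀ i, 0 < d i) {p v : SymMatrix m}
    (hp : L * p.toMatrix * Lᵀ = diagonal d) :
    0 < leadingMinor k p.toMatrix ∧
    HasDerivAt (fun r : ℝ => Real.log (leadingMinor k (p + r • v).toMatrix))
      (∑ i ∈ Finset.univ.filter (fun i : Fin m => (i : ℕ) < k),
        (d i)⁻¹ * (v.congr L).toMatrix i i) 0 := by
  have hprod : 0 < ∏ i : {i : Fin m // (i : ℕ) < k}, d i := Finset.prod_pos fun i _ => hd i
  have h1 : leadingMinor k L ^ 2 * leadingMinor k p.toMatrix =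
      ∏ i : {i : Fin m // (i : ℕ) < k}, d i := by
    rw [← leadingMinor_conj hlow, hp, leadingMinor_diagonal]
  have hL0 : leadingMinor k L ≠ 0 := by
    intro h0
    rw [h0] at h1
    simp at h1
    exact hprod.ne h1
  have hL2 : 0 < leadingMinor k L ^ 2 := by positivity
  have hpos : 0 < leadingMinor k p.toMatrix := by
    rw [← h1] at hprod
    exact (mul_pos_iff_of_pos_left hL2).1 hprod
  refine ⟨hpos, ?_⟩
  set P : Fin m → Prop := fun i => (i : ℕ) < k with hP
  set M : Matrix {i // P i} {i // P i} ℝ :=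
    diagonal (fun i : {i // P i} => (d i)⁻¹) * (v.congr L).toMatrix.toSquareBlockProp P with hM
  have h2 : ∀ r : ℝ, leadingMinor k (p + r • v).toMatrix =
      leadingMinor k p.toMatrix * (1 + r • M).det := fun r => by
    have h3 : leadingMinor k L ^ 2 * leadingMinor k (p + r • v).toMatrix =
        (∏ i : {i : Fin m // P i}, d i) * (1 + r • M).det := by
      rw [← leadingMinor_conj hlow, map_add, map_smul, Matrix.mul_add, Matrix.add_mul, hp,
        ← det_diagonal, ← det_mul, leadingMinor]
      congr 1
      rw [Matrix.mul_add, Matrix.mul_smul (diagonal _) r M, hM, ← Matrix.mul_assoc, diagonal_mul_diagonal]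
      have h4 : (fun i : {i // P i} => d i * (d i)⁻¹) = fun _ => 1 :=
        funext fun i => mul_inv_cancel₀ (hd i).ne'
      rw [h4, diagonal_one, Matrix.one_mul, Matrix.mul_one]
      ext i j
      simp [toSquareBlockProp_def, diagonal_apply, Subtype.ext_iff, P]
    rw [← h1, mul_assoc] at h3
    exact mul_left_cancel₀ hL2.ne' h3
  have h5 : HasDerivAt (fun r : ℝ => (1 + r • M).det) M.trace 0 := by
    rw [funext fun r : ℝ => det_one_add_smul r M]
    have ha : HasDerivAt (fun r : ℝ => 1 + M.trace * r) M.trace 0 := by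
      simpa using ((hasDerivAt_id (0 : ℝ)).const_mul M.trace).const_add 1
    set Q := (det (1 + (Polynomial.X : Polynomial ℝ) • M.map ⇑Polynomial.C)).divX.divX
    have hb : HasDerivAt (fun r : ℝ => Polynomial.eval r Q * r ^ 2) 0 0 := by
      have := (Q.hasDerivAt (0 : ℝ)).fun_mul (hasDerivAt_pow 2 (0 : ℝ))
      simpa using this
    simpa using ha.fun_add hb
  have h6 : M.trace = ∑ i ∈ Finset.univ.filter (fun i : Fin m => (i : ℕ) < k),
      (d i)⁻¹ * (v.congr L).toMatrix i i := by
    rw [trace]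
    simp only [hM, diag_apply, diagonal_mul, toSquareBlockProp_def, of_apply]
    exact (Finset.sum_subtype (Finset.univ.filter fun i : Fin m => (i : ℕ) < k) (by simp [P])
      fun i => (d i)⁻¹ * (v.congr L).toMatrix i i).symm
  rw [← h6]
  have h7 : HasDerivAt (fun r : ℝ => leadingMinor k (p + r • v).toMatrix)
      (leadingMinor k p.toMatrix * M.trace) 0 := by
    simp only [h2]
    exact h5.const_mul _
  have h8 := h7.log (by simpa using hpos.ne')
  simpa [hpos.ne'] using h8

end LeadingMinor

namespace PosDefMatrix

variable {m : ℕ}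

/-- The linear combination with coefficients `c i` of the logarithms of the diagonal part of `A`,
when `A` is decomposed as `L D Lᵀ` with `L` lower unitriangular and `D` diagonal. The entries of `D`
are quotients of consecutive leading minors. For suitably ordered `c`, this is a horofunction. -/
def iwasawaLog (c : Fin m → ℝ) (A : SymMatrix m) : ℝ :=
  ∑ k : Fin m, c k * (Real.log (leadingMinor (k + 1) A.toMatrix) -
    Real.log (leadingMinor k A.toMatrix))

theorem leadingMinor_pos (p : PosDefMatrix m) (k : ℕ) : 0 < leadingMinor k p.val.toMatrix := by
  obtain ⟨L, d, -, hlow, hd, hp⟩ := p.posDef.exists_lower_conj_eq_diagonal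
  exact (hasDerivAt_leadingMinor (v := 0) hlow hd hp).1

theorem contDiffAt_iwasawaLog (c : Fin m → ℝ) (p : PosDefMatrix m) :
    ContDiffAt ℝ ∞ (iwasawaLog c) p.val := by
  refine ContDiffAt.sum fun k _ => contDiffAt_const.mul (ContDiffAt.sub ?_ ?_) <;>
  exact (contDiff_leadingMinor _).contDiffAt.log (p.leadingMinor_pos _).ne'

/-- After a lower triangular congruence the point becomes diagonal, where the differential involves the
diagonal entries of `v` only. -/
theorem sq_fderiv_iwasawaLog_le {c : Fin m → ℝ} (hc : ∑ i, c i ^ 2 ≤ 1) (p : PosDefMatrix m)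
    (v : SymMatrix m) :
    (fderiv ℝ (iwasawaLog c) p.val v) ^ 2 ≤ traceForm p.val.toMatrix⁻¹ v v := by
  obtain ⟨L, d, -, hlow, hd, hp, hform⟩ := p.exists_traceForm_eq_sum
  set w := (v.congr L).toMatrix with hw
  have h1 : fderiv ℝ (iwasawaLog c) p.val v = ∑ k, c k * ((d k)⁻¹ * w k k) := by
    have hline : HasDerivAt (fun r : ℝ => p.val + r • v) v 0 := by
      simpa using ((hasDerivAt_id (0 : ℝ)).smul_const v).const_add p.val
    have hF : HasFDerivAt (iwasawaLog c) (fderiv ℝ (iwasawaLog c) p.val) (p.val + (0 : ℝ) • v) := by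
      rw [zero_smul, add_zero]
      exact ((contDiffAt_iwasawaLog c p).differentiableAt (by simp)).hasFDerivAt
    have h2 := hF.comp_hasDerivAt (0 : ℝ) hline
    have h3 : HasDerivAt (iwasawaLog c ∘ fun r : ℝ => p.val + r • v)
        (∑ k, c k * ((d k)⁻¹ * w k k)) 0 := by
      have : (iwasawaLog c ∘ fun r : ℝ => p.val + r • v) = fun r => ∑ k : Fin m, c k *
        (Real.log (leadingMinor (k + 1) (p.val + r • v).toMatrix) -
          Real.log (leadingMinor k (p.val + r • v).toMatrix)) := rfl
      rw [this]
      refine HasDerivAt.fun_sum fun k _ => HasDerivAt.const_mul _ ?_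
      have h4 := (hasDerivAt_leadingMinor (k := k + 1) (v := v) hlow hd hp).2.sub
        (hasDerivAt_leadingMinor (k := k) (v := v) hlow hd hp).2
      have h5 : (Finset.univ.filter fun i : Fin m => (i : ℕ) < k + 1) =
          insert k (Finset.univ.filter fun i : Fin m => (i : ℕ) < k) := by
        ext i
        simp [Fin.ext_iff]
        omega
      rw [h5, Finset.sum_insert (by simp), add_sub_cancel_right] at h4
      exact h4
    exact h2.unique h3
  rw [h1, hform]
  have hnn : ∀ i j, 0 ≤ (d i)⁻¹ * (d j)⁻¹ * w i j ^ 2 := fun i j =>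
    mul_nonneg (mul_pos (inv_pos.2 (hd i)) (inv_pos.2 (hd j))).le (sq_nonneg _)
  calc (∑ k, c k * ((d k)⁻¹ * w k k)) ^ 2
      ≤ (∑ k, c k ^ 2) * ∑ k, ((d k)⁻¹ * w k k) ^ 2 := Finset.sum_mul_sq_le_sq_mul_sq _ _ _
    _ ≤ 1 * ∑ k, ((d k)⁻¹ * w k k) ^ 2 :=
        mul_le_mul_of_nonneg_right hc (Finset.sum_nonneg fun _ _ => sq_nonneg _)
    _ = ∑ k, (d k)⁻¹ * (d k)⁻¹ * w k k ^ 2 := by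
        rw [one_mul]
        exact Finset.sum_congr rfl fun k _ => by ring
    _ ≤ ∑ i, ∑ j, (d i)⁻¹ * (d j)⁻¹ * w i j ^ 2 :=
        Finset.sum_le_sum fun i _ =>
          Finset.single_le_sum (f := fun j => (d i)⁻¹ * (d j)⁻¹ * w i j ^ 2)
            (fun j _ => hnn i j) (Finset.mem_univ i)

/-- The functions `iwasawaLog c`, for unit vectors `c`, bound the distance from below. -/
theorem edist_iwasawaLog_le {c : Fin m → ℝ} (hc : ∑ i, c i ^ 2 ≤ 1) (p q : PosDefMatrix m) :
    edist (iwasawaLog c p.val) (iwasawaLog c q.val) ≤ rdist p q := by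
  rw [IsRiemannianManifold.out (I := 𝓘(ℝ, ℝ)) (iwasawaLog c p.val) (iwasawaLog c q.val)]
  refine riemannianEDist_map_le (Φ := fun q : PosDefMatrix m => iwasawaLog c q.val)
    (fun x => ?_) (fun x v => ?_) p q
  · exact ((contDiffAt_iwasawaLog c x).of_le (by simp)).contMDiffAt.comp x contMDiff_val.contMDiffAt
  · rw [norm_tangent_eq, norm_tangentSpace_vectorSpace,
      mfderiv_eq_fderiv ((contDiffAt_iwasawaLog c x).differentiableAt (by simp))]
    refine Real.le_sqrt_of_sq_le ?_
    rw [Real.norm_eq_abs, sq_abs]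
    exact sq_fderiv_iwasawaLog_le hc x v

end PosDefMatrix

/-! ### Distances in the flat of diagonal matrices -/

namespace PosDefMatrix

variable {m : ℕ}

/-- Diagonal matrices, as symmetric matrices. -/
def symDiagonal : (Fin m → ℝ) →ₗ[ℝ] SymMatrix m where
  toFun d := .mk (diagonal d) (Matrix.isSymm_diagonal d)
  map_add' d e := SymMatrix.toMatrix_injective (diagonal_add d e).symm
  map_smul' c d := SymMatrix.toMatrix_injective (diagonal_smul c d)

@[simp] theorem toMatrix_symDiagonal (d : Fin m → ℝ) :
    (symDiagonal d).toMatrix = diagonal d := rfl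

/-- The diagonal matrix with entries `exp (a i)`. The matrices `expDiagonal a` form a maximal flat
through the identity. -/
def expDiagonal (a : Fin m → ℝ) : PosDefMatrix m where
  val := symDiagonal fun i => Real.exp (a i)
  posDef := Matrix.PosDef.diagonal fun i => Real.exp_pos (a i)

theorem iwasawaLog_expDiagonal (c a : Fin m → ℝ) :
    iwasawaLog c (expDiagonal a).val = ∑ i, c i * a i := by
  refine Finset.sum_congr rfl fun k _ => ?_
  have h : ∀ j : ℕ, Real.log (leadingMinor j (expDiagonal a).val.toMatrix) =
      ∑ i ∈ Finset.univ.filter (fun i : Fin m => (i : ℕ) < j), a i := fun j => by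
    rw [show (expDiagonal a).val.toMatrix = diagonal fun i => Real.exp (a i) from rfl,
      leadingMinor_diagonal, Real.log_prod fun i _ => (Real.exp_pos _).ne']
    simp only [Real.log_exp]
    exact (Finset.sum_subtype (Finset.univ.filter fun i : Fin m => (i : ℕ) < j) (by simp)
      fun i => a i).symm
  have h5 : (Finset.univ.filter fun i : Fin m => (i : ℕ) < k + 1) =
      insert k (Finset.univ.filter fun i : Fin m => (i : ℕ) < k) := by
    ext i
    simp [Fin.ext_iff]
    omega
  rw [h, h, h5, Finset.sum_insert (by simp), add_sub_cancel_right]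

/-- Lines in the flat of diagonal matrices are paths of unit speed. -/
theorem rdist_expDiagonal_line_le {c : Fin m → ℝ} (hc : ∑ i, c i ^ 2 = 1) (a : Fin m → ℝ)
    (s t : ℝ) : rdist (expDiagonal (a + s • c)) (expDiagonal (a + t • c)) ≤ edist s t := by
  rw [IsRiemannianManifold.out (I := 𝓘(ℝ, ℝ)) s t]
  have hd : ∀ s : ℝ, HasDerivAt (fun s : ℝ => (expDiagonal (a + s • c)).val)
      (symDiagonal fun i => Real.exp (a i + s * c i) * c i) s := fun s => by
    have h1 : HasDerivAt (fun s : ℝ => fun i => Real.exp (a i + s * c i))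
        (fun i => Real.exp (a i + s * c i) * c i) s := by
      refine hasDerivAt_pi.2 fun i => HasDerivAt.exp ?_
      simpa using ((hasDerivAt_id s).mul_const (c i)).const_add (a i)
    exact (LinearMap.toContinuousLinearMap (symDiagonal (m := m))).hasFDerivAt.comp_hasDerivAt s h1
  have hs : ContMDiff 𝓘(ℝ, ℝ) 𝓘(ℝ, SymMatrix m) 1 fun s : ℝ => expDiagonal (a + s • c) := by
    refine ContMDiff.of_comp_isOpenEmbedding isOpenEmbedding_val ?_
    refine ContDiff.contMDiff ?_
    refine (symDiagonal (m := m)).contDiff_of_finiteDimensional.comp (contDiff_pi.2 fun i => ?_)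
    refine Real.contDiff_exp.comp ?_
    simp only [Pi.add_apply, Pi.smul_apply, smul_eq_mul]
    fun_prop
  refine riemannianEDist_map_le hs (fun x v' => ?_) s t
  rw [norm_tangent_eq, norm_tangentSpace_vectorSpace]
  let v : ℝ := v'
  have h2 : (mfderiv 𝓘(ℝ, ℝ) 𝓘(ℝ, SymMatrix m) (fun s : ℝ => expDiagonal (a + s • c)) x v' :
      SymMatrix m) = v • symDiagonal fun i => Real.exp (a i + x * c i) * c i := by
    have h := mfderiv_comp_apply (I := 𝓘(ℝ, ℝ)) (I' := 𝓘(ℝ, SymMatrix m))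
      (I'' := 𝓘(ℝ, SymMatrix m)) x (g := val) (f := fun s : ℝ => expDiagonal (a + s • c))
      (contMDiff_val.mdifferentiable (n := 1) one_ne_zero _)
      (hs.mdifferentiable one_ne_zero x) v'
    rw [mfderiv_val] at h
    rw [← h, _root_.mfderiv_eq_fderiv]
    exact congrArg (fun f => f v) (hd x).hasFDerivAt.fderiv
  rw [h2]
  have h3 : (expDiagonal (a + x • c)).val.toMatrix⁻¹ =
      diagonal fun i => Real.exp (-(a i + x * c i)) := by
    refine Matrix.inv_eq_right_inv ?_
    rw [show (expDiagonal (a + x • c)).val.toMatrix =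
      diagonal fun i => Real.exp (a i + x * c i) from rfl, diagonal_mul_diagonal, ← diagonal_one]
    congr 1
    ext i
    rw [← Real.exp_add]
    simp
  rw [h3, traceForm_self_eq_sum]
  have h4 : ∀ i j, (v • symDiagonal fun i => Real.exp (a i + x * c i) * c i).toMatrix i j =
      if i = j then v * (Real.exp (a i + x * c i) * c i) else 0 := fun i j => by
    rw [map_smul, toMatrix_symDiagonal, Matrix.smul_apply, diagonal_apply]
    split_ifs <;> simp
  have h5 : ∑ i, ∑ j, Real.exp (-(a i + x * c i)) * Real.exp (-(a j + x * c j)) *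
      (v • symDiagonal fun i => Real.exp (a i + x * c i) * c i).toMatrix i j ^ 2 =
      v ^ 2 := by
    simp only [h4, ite_pow, mul_ite]
    simp only [ne_eq, OfNat.ofNat_ne_zero, not_false_eq_true, zero_pow, mul_zero,
      Finset.sum_ite_eq, Finset.mem_univ, if_true]
    rw [← mul_one (v ^ 2), ← hc, Finset.mul_sum]
    refine Finset.sum_congr rfl fun i _ => ?_
    have : Real.exp (-(a i + x * c i)) * Real.exp (a i + x * c i) = 1 := by
      rw [← Real.exp_add]; simp
    linear_combination v ^ 2 * c i ^ 2 *
      (Real.exp (-(a i + x * c i)) * Real.exp (a i + x * c i) + 1) * this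
  rw [h5, Real.sqrt_sq_eq_abs]
  exact (Real.norm_eq_abs v).ge

/-- The diagonal matrices are a flat. The two bounds come from the line through the points, and from
the function `iwasawaLog c` in its direction `c`. -/
theorem rdist_expDiagonal (a b : Fin m → ℝ) :
    rdist (expDiagonal a) (expDiagonal b) = ENNReal.ofReal √(∑ i, (b i - a i) ^ 2) := by
  set r := √(∑ i, (b i - a i) ^ 2) with hr
  have hsum : 0 ≤ ∑ i, (b i - a i) ^ 2 := Finset.sum_nonneg fun _ _ => sq_nonneg _
  have hr2 : r ^ 2 = ∑ i, (b i - a i) ^ 2 := Real.sq_sqrt hsum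
  obtain h0 | hpos := (Real.sqrt_nonneg (∑ i, (b i - a i) ^ 2)).eq_or_lt
  · rw [← hr] at h0
    have hab : a = b := by
      rw [← h0] at hr2
      ext i
      have := (Finset.sum_eq_zero_iff_of_nonneg (fun i _ => sq_nonneg (b i - a i))).1
        (hr2.symm.trans (by simp)) i (Finset.mem_univ i)
      have := pow_eq_zero_iff (two_ne_zero) |>.1 this
      linarith
    rw [← h0, hab]
    simp [rdist, Manifold.riemannianEDist_self]
  rw [← hr] at hpos
  set c : Fin m → ℝ := fun i => (b i - a i) / r with hcdef
  have hc : ∑ i, c i ^ 2 = 1 := by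
    simp only [hcdef, div_pow]
    rw [← Finset.sum_div, ← hr2]
    exact div_self (by positivity)
  have hb : b = a + r • c := by
    ext i
    simp [hcdef]
    field_simp
    ring
  have he : edist (0 : ℝ) r = ENNReal.ofReal r := by
    rw [edist_dist, Real.dist_eq, zero_sub, abs_neg, abs_of_pos hpos]
  refine le_antisymm ?_ ?_
  · have := rdist_expDiagonal_line_le hc a 0 r
    rwa [zero_smul, add_zero, ← hb, he] at this
  · have := edist_iwasawaLog_le hc.le (expDiagonal a) (expDiagonal b)
    rw [iwasawaLog_expDiagonal, iwasawaLog_expDiagonal, edist_dist, Real.dist_eq, abs_sub_comm,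
      ← Finset.sum_sub_distrib] at this
    have h6 : ∑ i, (c i * b i - c i * a i) = r := by
      have : ∀ i, c i * b i - c i * a i = r * c i ^ 2 := fun i => by
        simp only [hcdef]
        field_simp
      simp only [this]
      rw [← Finset.mul_sum, hc, mul_one]
    rwa [h6, abs_of_pos hpos] at this

/-- Simultaneous diagonalisation: any two points lie on a common maximal flat. -/
theorem exists_congr_expDiagonal (p q : PosDefMatrix m) :
    ∃ (g : GL (Fin m) ℝ) (a : Fin m → ℝ),
      p = congr g (expDiagonal 0) ∧ q = congr g (expDiagonal a) := by
  have h1 : ∃ g : GL (Fin m) ℝ, p = congr g (expDiagonal 0) := by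
    obtain ⟨L, d, hL, -, hd, h⟩ := p.posDef.exists_lower_conj_eq_diagonal
    have hS : IsUnit (diagonal fun i => √(d i)) := by
      rw [Matrix.isUnit_iff_isUnit_det, det_diagonal, isUnit_iff_ne_zero]
      exact (Finset.prod_pos fun i _ => Real.sqrt_pos.2 (hd i)).ne'
    obtain ⟨U, rfl⟩ := hL
    obtain ⟨D, hD⟩ := hS
    refine ⟨U⁻¹ * D, ?_⟩
    have h2 : congr U p = congr D (expDiagonal 0) := by
      refine PosDefMatrix.ext (SymMatrix.toMatrix_injective ?_)
      refine h.trans ?_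
      change _ = (D : Matrix (Fin m) (Fin m) ℝ) * diagonal (fun i => Real.exp 0) *
        (D : Matrix (Fin m) (Fin m) ℝ)ᵀ
      simp [hD, Real.mul_self_sqrt (hd _).le]
    rw [congr_mul, ← h2, ← congr_mul, inv_mul_cancel, congr_one]
  obtain ⟨g, hg⟩ := h1
  set q' := congr g⁻¹ q with hq'
  have hH := q'.posDef.isHermitian
  have hspec := hH.spectral_theorem
  have hpos : ∀ i, 0 < hH.eigenvalues i := fun i => q'.posDef.eigenvalues_pos i
  set U : GL (Fin m) ℝ := Unitary.toUnits hH.eigenvectorUnitary with hU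
  have hUU : (U : Matrix (Fin m) (Fin m) ℝ) * (U : Matrix (Fin m) (Fin m) ℝ)ᵀ = 1 := by
    rw [← conjTranspose_eq_transpose_of_trivial]
    exact Unitary.coe_mul_star_self hH.eigenvectorUnitary
  refine ⟨g * U, fun i => Real.log (hH.eigenvalues i), ?_, ?_⟩
  · rw [congr_mul, hg]
    congr 1
    refine PosDefMatrix.ext (SymMatrix.toMatrix_injective ?_)
    change diagonal (fun i => Real.exp 0) = (U : Matrix (Fin m) (Fin m) ℝ) *
      diagonal (fun i => Real.exp 0) * (U : Matrix (Fin m) (Fin m) ℝ)ᵀ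
    simp [hUU]
  · have h3 : q = congr g q' := by rw [hq', ← congr_mul, mul_inv_cancel, congr_one]
    rw [congr_mul]
    refine h3.trans ?_
    congr 1
    refine PosDefMatrix.ext (SymMatrix.toMatrix_injective ?_)
    refine hspec.trans ?_
    change _ = (U : Matrix (Fin m) (Fin m) ℝ) *
      diagonal (fun i => Real.exp (Real.log (hH.eigenvalues i))) *
        (U : Matrix (Fin m) (Fin m) ℝ)ᵀ
    simp only [Real.exp_log (hpos _)]
    rw [Unitary.conjStarAlgAut_apply, ← conjTranspose_eq_transpose_of_trivial]
    rfl

theorem rdist_ne_top (p q : PosDefMatrix m) : rdist p q ≠ ⊤ := by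
  obtain ⟨g, a, rfl, rfl⟩ := exists_congr_expDiagonal p q
  rw [rdist_congr, rdist_expDiagonal]
  exact ENNReal.ofReal_ne_top

instance : MetricSpace (PosDefMatrix m) :=
  letI : EMetricSpace (PosDefMatrix m) :=
    EMetricSpace.ofRiemannianMetric 𝓘(ℝ, SymMatrix m) (PosDefMatrix m)
  EMetricSpace.toMetricSpace rdist_ne_top

instance : IsRiemannianManifold 𝓘(ℝ, SymMatrix m) (PosDefMatrix m) := ⟨fun _ _ => rfl⟩

theorem isMetricOfRiemannianManifold : IsMetricOfRiemannianManifold (PosDefMatrix m) :=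
  ⟨inferInstance, SymMatrix m, inferInstance, inferInstance, inferInstance, inferInstance,
    inferInstance, inferInstance, inferInstance, inferInstance⟩

end PosDefMatrix

/-! ### The symmetric space of positive definite matrices -/

/-- A space in which every `y` is the midpoint of any `x` and its image `s` under some map, in the
sense that `d(x, s) = 2 d(x, y)` and `d(y, s) = d(x, y)`, has no compact factor. -/
theorem HasNoCompactFactor.of_forall_exists_dist_eq {X : Type} [MetricSpace X] [Nonempty X]
    (h : ∀ x y : X, ∃ z, dist x z = 2 * dist x y ∧ dist y z = dist x y) :
    HasNoCompactFactor X := by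
  intro Y Z _ _ _ ⟨e⟩
  by_contra hZ
  rw [not_subsingleton_iff_nontrivial] at hZ
  obtain ⟨z₁, z₂, hne⟩ := hZ.exists_pair_ne
  obtain ⟨⟨a, b⟩, -, hmax⟩ := (isCompact_univ (X := Z × Z)).exists_isMaxOn
    ⟨(z₁, z₂), Set.mem_univ _⟩ (f := fun w => dist w.1 w.2) continuous_dist.continuousOn
  have hmax : ∀ z z' : Z, dist z z' ≤ dist a b := fun z z' => hmax (Set.mem_univ (z, z'))
  have hab : 0 < dist a b := (dist_pos.2 hne).trans_le (hmax z₁ z₂)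
  obtain ⟨y⟩ : Nonempty Y := (‹Nonempty X›).map fun x => (e x).fst
  have hsq : ∀ u v : WithLp 2 (Y × Z), dist u v ^ 2 = dist u.fst v.fst ^ 2 + dist u.snd v.snd ^ 2 :=
    fun u v => by
      rw [WithLp.prod_dist_eq_add (by norm_num)]
      simp only [ENNReal.toReal_ofNat, Real.rpow_ofNat]
      rw [← Real.sqrt_eq_rpow, Real.sq_sqrt (by positivity)]
  set u : WithLp 2 (Y × Z) := WithLp.toLp 2 (y, a) with hu
  set v : WithLp 2 (Y × Z) := WithLp.toLp 2 (y, b) with hv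
  obtain ⟨z, h1, h2⟩ := h (e.symm u) (e.symm v)
  set w := e z with hw
  have hz : z = e.symm w := (e.symm_apply_apply z).symm
  rw [hz, e.symm.dist_eq, e.symm.dist_eq] at h1 h2
  have huv : dist u v ^ 2 = dist a b ^ 2 := by
    rw [hsq, show u.fst = v.fst from rfl, dist_self]
    simp [hu, hv]
  have huw := hsq u w
  have hvw := hsq v w
  have hfst : dist u.fst w.fst = dist v.fst w.fst := rfl
  have h3 : dist u.snd w.snd ^ 2 ≤ dist a b ^ 2 :=
    pow_le_pow_left₀ dist_nonneg (hmax _ _) 2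
  rw [h1, mul_pow, huv] at huw
  rw [h2, huv] at hvw
  nlinarith [sq_nonneg (dist v.snd w.snd), pow_pos hab 2, hfst ▸ huw]

namespace PosDefMatrix

variable {m : ℕ}

theorem dist_eq_toReal (p q : PosDefMatrix m) : dist p q = (rdist p q).toReal := rfl

theorem dist_expDiagonal (a b : Fin m → ℝ) :
    dist (expDiagonal a) (expDiagonal b) = √(∑ i, (b i - a i) ^ 2) := by
  rw [dist_eq_toReal, rdist_expDiagonal, ENNReal.toReal_ofReal (Real.sqrt_nonneg _)]

/-- The isometric action of `GL(m, ℝ)` by congruences. -/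
def congrIsometry : GL (Fin m) ℝ →* (PosDefMatrix m ≃ᵢ PosDefMatrix m) where
  toFun A :=
    { toFun := congr A
      invFun := congr A⁻¹
      left_inv := fun p => by rw [← congr_mul, inv_mul_cancel, congr_one]
      right_inv := fun p => by rw [← congr_mul, mul_inv_cancel, congr_one]
      isometry_toFun := rdist_congr A }
  map_one' := IsometryEquiv.ext congr_one
  map_mul' A B := IsometryEquiv.ext (congr_mul A B)

theorem dist_congr (A : GL (Fin m) ℝ) (p q : PosDefMatrix m) :
    dist (congr A p) (congr A q) = dist p q := (congrIsometry A).dist_eq p q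

/-- The geodesic symmetry `p ↦ q p⁻¹ q` at `q`. -/
def symmetry (q p : PosDefMatrix m) : PosDefMatrix m := congr q.posDef.isUnit.unit p.inv

theorem toMatrix_symmetry (q p : PosDefMatrix m) :
    (symmetry q p).val.toMatrix = q.val.toMatrix * p.val.toMatrix⁻¹ * q.val.toMatrix := by
  change q.val.toMatrix * p.val.toMatrix⁻¹ * q.val.toMatrixᵀ = _
  rw [q.val.isSymm.eq]

theorem symmetry_symmetry (q p : PosDefMatrix m) : symmetry q (symmetry q p) = p := by
  refine PosDefMatrix.ext (SymMatrix.toMatrix_injective ?_)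
  rw [toMatrix_symmetry, toMatrix_symmetry, Matrix.mul_inv_rev, Matrix.mul_inv_rev,
    Matrix.inv_eq_left_inv p.mul_inv_self]
  simp only [Matrix.mul_assoc]
  rw [q.inv_mul_self, Matrix.mul_one, ← Matrix.mul_assoc, q.mul_inv_self, Matrix.one_mul]

theorem symmetry_congr (A : GL (Fin m) ℝ) (q p : PosDefMatrix m) :
    symmetry (congr A q) (congr A p) = congr A (symmetry q p) := by
  have hA : (A : Matrix (Fin m) (Fin m) ℝ)⁻¹ * A = 1 := by
    rw [← Matrix.coe_units_inv, ← Units.val_mul, inv_mul_cancel, Units.val_one]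
  have hA' : (A : Matrix (Fin m) (Fin m) ℝ)ᵀ * (A : Matrix (Fin m) (Fin m) ℝ)ᵀ⁻¹ = 1 := by
    rw [← Matrix.transpose_nonsing_inv, ← Matrix.transpose_mul, hA, Matrix.transpose_one]
  refine PosDefMatrix.ext (SymMatrix.toMatrix_injective ?_)
  rw [toMatrix_symmetry]
  change A * q.val.toMatrix * (A : Matrix (Fin m) (Fin m) ℝ)ᵀ *
    (A * p.val.toMatrix * (A : Matrix (Fin m) (Fin m) ℝ)ᵀ)⁻¹ *
    (A * q.val.toMatrix * (A : Matrix (Fin m) (Fin m) ℝ)ᵀ) =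
    A * (symmetry q p).val.toMatrix * (A : Matrix (Fin m) (Fin m) ℝ)ᵀ
  rw [toMatrix_symmetry, Matrix.mul_inv_rev, Matrix.mul_inv_rev]
  have h1 : ∀ X, (A : Matrix (Fin m) (Fin m) ℝ)⁻¹ * (A * X) = X := fun X => by
    rw [← Matrix.mul_assoc, hA, Matrix.one_mul]
  have h2 : ∀ X, (A : Matrix (Fin m) (Fin m) ℝ)ᵀ *
      ((A : Matrix (Fin m) (Fin m) ℝ)ᵀ⁻¹ * X) = X := fun X => by
    rw [← Matrix.mul_assoc, hA', Matrix.one_mul]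
  simp only [Matrix.mul_assoc, h1, h2]

theorem symmetry_expDiagonal_zero (a : Fin m → ℝ) :
    symmetry (expDiagonal 0) (expDiagonal a) = expDiagonal (-a) := by
  refine PosDefMatrix.ext (SymMatrix.toMatrix_injective ?_)
  have h0 : (expDiagonal (0 : Fin m → ℝ)).val.toMatrix = 1 := by
    change diagonal (fun i => Real.exp 0) = 1
    simp
  rw [toMatrix_symmetry, h0, Matrix.one_mul, Matrix.mul_one]
  refine Matrix.inv_eq_right_inv ?_
  change diagonal (fun i => Real.exp (a i)) * diagonal (fun i => Real.exp (-a i)) = 1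
  rw [diagonal_mul_diagonal, ← diagonal_one]
  congr 1
  ext i
  rw [← Real.exp_add, add_neg_cancel, Real.exp_zero]

theorem symmetry_self (q : PosDefMatrix m) : symmetry q q = q := by
  refine PosDefMatrix.ext (SymMatrix.toMatrix_injective ?_)
  rw [toMatrix_symmetry, q.mul_inv_self, Matrix.one_mul]

/-- The symmetries move points to twice their distance from the centre. In particular the centre is
the only fixed point. -/
theorem dist_self_symmetry (q p : PosDefMatrix m) : dist p (symmetry q p) = 2 * dist p q := by
  obtain ⟨g, a, rfl, rfl⟩ := exists_congr_expDiagonal q p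
  rw [symmetry_congr, dist_congr, dist_congr, symmetry_expDiagonal_zero, dist_expDiagonal,
    dist_expDiagonal]
  have h : ∑ i, ((-a) i - a i) ^ 2 = 2 ^ 2 * ∑ i, ((0 : Fin m → ℝ) i - a i) ^ 2 := by
    rw [Finset.mul_sum]
    refine Finset.sum_congr rfl fun i _ => ?_
    simp only [Pi.neg_apply, Pi.zero_apply]
    ring
  rw [h, Real.sqrt_mul (by positivity), Real.sqrt_sq (by positivity)]

/-- The geodesic symmetry at `q`, as an isometry. -/
def symmetryIsometry (q : PosDefMatrix m) : PosDefMatrix m ≃ᵢ PosDefMatrix m where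
  toFun := symmetry q
  invFun := symmetry q
  left_inv := symmetry_symmetry q
  right_inv := symmetry_symmetry q
  isometry_toFun _ _ := (rdist_congr _ _ _).trans (rdist_inv _ _)

theorem isRiemannianSymmetricSpace : IsRiemannianSymmetricSpace (PosDefMatrix m) := by
  refine ⟨isMetricOfRiemannianManifold, fun q => ⟨symmetryIsometry q, symmetry_self q,
    symmetry_symmetry q, Filter.Eventually.of_forall fun p (hp : symmetry q p = p) => ?_⟩⟩
  have := dist_self_symmetry q p
  rw [hp, dist_self] at this
  exact dist_eq_zero.1 (by linarith)

theorem hasNoCompactFactor : HasNoCompactFactor (PosDefMatrix m) := by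
  refine HasNoCompactFactor.of_forall_exists_dist_eq fun p q =>
    ⟨symmetry q p, dist_self_symmetry q p, ?_⟩
  have := (symmetryIsometry q).dist_eq q p
  rw [dist_comm p q, ← this]
  exact congrArg (dist · (symmetry q p)) (symmetry_self q).symm

end PosDefMatrix

/-- A group with property FSI is orthogonal, up to conjugation, in each real representation. -/
theorem PropertyFSI.exists_conj_orthogonal {Γ : Type*} [Group Γ] (hΓ : PropertyFSI Γ) {m : ℕ}
    (ρ : Γ →* GL (Fin m) ℝ) : ∃ B : GL (Fin m) ℝ, ∀ g,
      ((B * ρ g * B⁻¹ : GL (Fin m) ℝ) : Matrix (Fin m) (Fin m) ℝ) *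
        ((B * ρ g * B⁻¹ : GL (Fin m) ℝ) : Matrix (Fin m) (Fin m) ℝ)ᵀ = 1 := by
  obtain ⟨p, hp⟩ := hΓ.1 (PosDefMatrix m) PosDefMatrix.isRiemannianSymmetricSpace
    PosDefMatrix.hasNoCompactFactor (PosDefMatrix.congrIsometry.comp ρ)
  obtain ⟨B, -, hB, -⟩ := PosDefMatrix.exists_congr_expDiagonal p p
  refine ⟨B⁻¹, fun g => ?_⟩
  have h1 : PosDefMatrix.congr (ρ g) p = p := hp g
  have h2 : PosDefMatrix.congr (B⁻¹ * ρ g * B⁻¹⁻¹) (PosDefMatrix.expDiagonal 0) =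
      PosDefMatrix.expDiagonal 0 := by
    rw [_root_.inv_inv, PosDefMatrix.congr_mul, ← hB, PosDefMatrix.congr_mul, h1, hB,
      ← PosDefMatrix.congr_mul, inv_mul_cancel, PosDefMatrix.congr_one]
  have h3 := congrArg (fun q => q.val.toMatrix) h2
  have h0 : (PosDefMatrix.expDiagonal (0 : Fin m → ℝ)).val.toMatrix = 1 := by
    change diagonal (fun i => Real.exp 0) = 1
    simp
  simp only [h0] at h3
  rw [← h3]
  change _ = ((B⁻¹ * ρ g * B⁻¹⁻¹ : GL (Fin m) ℝ) : Matrix (Fin m) (Fin m) ℝ) *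
    (PosDefMatrix.expDiagonal (0 : Fin m → ℝ)).val.toMatrix *
    ((B⁻¹ * ρ g * B⁻¹⁻¹ : GL (Fin m) ℝ) : Matrix (Fin m) (Fin m) ℝ)ᵀ
  rw [h0, Matrix.mul_one]

end

noncomputable section

open Topology Matrix

/-! ### Real representations -/

theorem Set.Finite.of_isBounded_of_separated {X : Type*} [PseudoMetricSpace X] [ProperSpace X]
    {S : Set X} (hb : Bornology.IsBounded S) {δ : ℝ} (hδ : 0 < δ)
    (h : ∀ x ∈ S, ∀ y ∈ S, dist x y < δ → x = y) : S.Finite := by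
  have ht : TotallyBounded S := hb.isCompact_closure.totallyBounded.subset subset_closure
  obtain ⟨t, ht, hS⟩ := Metric.totallyBounded_iff.1 ht (δ / 2) (half_pos hδ)
  have hc : ∀ x ∈ S, ∃ y ∈ t, dist x y < δ / 2 := fun x hx => by
    simpa using hS hx
  choose! f hft hf using hc
  refine Set.Finite.of_injOn (f := f) hft (fun x hx y hy hxy => h x hx y hy ?_) ht
  have h1 := hf x hx
  have h2 := hf y hy
  rw [← hxy] at h2
  have := dist_triangle_right x y (f x)
  linarith

theorem Matrix.abs_apply_le_one_of_mul_transpose_eq_one {m : ℕ} {U : Matrix (Fin m) (Fin m) ℝ}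
    (hU : U * Uᵀ = 1) (i j : Fin m) : |U i j| ≤ 1 := by
  have h : ∑ k, U i k ^ 2 = 1 := by
    have := congrFun (congrFun hU i) i
    rw [Matrix.mul_apply, one_apply_eq] at this
    simpa [sq] using this
  rw [← sq_le_one_iff_abs_le_one, ← h]
  exact Finset.single_le_sum (f := fun k => U i k ^ 2) (fun _ _ => sq_nonneg _) (Finset.mem_univ j)

theorem Matrix.abs_trace_le_of_mul_transpose_eq_one {m : ℕ} {U : Matrix (Fin m) (Fin m) ℝ}
    (hU : U * Uᵀ = 1) : |U.trace| ≤ m := by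
  refine (Finset.abs_sum_le_sum_abs _ _).trans ?_
  refine (Finset.sum_le_card_nsmul _ _ 1
    fun i _ => Matrix.abs_apply_le_one_of_mul_transpose_eq_one hU i i).trans ?_
  simp

namespace PropertyFSI

variable {Γ : Type*} [Group Γ]

/-- A real representation is conjugate to an orthogonal one, hence has bounded traces. -/
theorem abs_trace_le (hΓ : PropertyFSI Γ) {m : ℕ} (ρ : Γ →* GL (Fin m) ℝ) (g : Γ) :
    |(ρ g : Matrix (Fin m) (Fin m) ℝ).trace| ≤ m := by
  obtain ⟨B, hB⟩ := hΓ.exists_conj_orthogonal ρ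
  have := Matrix.abs_trace_le_of_mul_transpose_eq_one (hB g)
  rwa [Units.val_mul, Units.val_mul, Matrix.trace_units_conj] at this

/-- A group of orthogonal matrices whose elements have finitely many traces is finite: the traces
determine the mutual distances of the elements, which hence form a separated bounded set. -/
theorem finite_range_of_finite_trace (hΓ : PropertyFSI Γ) {m : ℕ} (ρ : Γ →* GL (Fin m) ℝ)
    (hfin : (Set.range fun g => (ρ g : Matrix (Fin m) (Fin m) ℝ).trace).Finite) :
    (Set.range ρ).Finite := by
  obtain ⟨B, hB⟩ := hΓ.exists_conj_orthogonal ρ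
  set σ : Γ →* GL (Fin m) ℝ := (MulAut.conj B).toMonoidHom.comp ρ with hσ
  have hσB : ∀ g, (σ g : Matrix (Fin m) (Fin m) ℝ) * (σ g : Matrix (Fin m) (Fin m) ℝ)ᵀ = 1 := hB
  have htr : ∀ g, (σ g : Matrix (Fin m) (Fin m) ℝ).trace =
      (ρ g : Matrix (Fin m) (Fin m) ℝ).trace := fun g => by
    change ((B * ρ g * B⁻¹ : GL (Fin m) ℝ) : Matrix (Fin m) (Fin m) ℝ).trace = _
    rw [Units.val_mul, Units.val_mul, Matrix.trace_units_conj]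
  have hinv : ∀ g h, (σ g : Matrix (Fin m) (Fin m) ℝ) * (σ h : Matrix (Fin m) (Fin m) ℝ)ᵀ =
      σ (g * h⁻¹) := fun g h => by
    have h1 : (σ h⁻¹ : Matrix (Fin m) (Fin m) ℝ) * σ h = 1 := by
      rw [← Units.val_mul, ← map_mul, inv_mul_cancel, map_one, Units.val_one]
    have h2 : (σ h : Matrix (Fin m) (Fin m) ℝ)ᵀ = σ h⁻¹ := (left_inv_eq_right_inv h1 (hσB h)).symm
    rw [h2, map_mul, Units.val_mul]
  set T := Set.range fun g => (ρ g : Matrix (Fin m) (Fin m) ℝ).trace with hT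
  -- `W` contains the squared Frobenius distances `2 m - tr (u vᵀ) - tr (v uᵀ)` of the image.
  set W : Set ℝ := (fun z : ℝ × ℝ => 2 * m - z.1 - z.2) '' (T ×ˢ T) with hW
  have hWfin : W.Finite := (hfin.prod hfin).image _
  obtain ⟨ε, hε, hεW⟩ : ∃ ε > 0, ∀ w ∈ W, 0 < w → ε ≤ w := by
    obtain hemp | hne := (W ∩ Set.Ioi 0).eq_empty_or_nonempty
    · refine ⟨1, one_pos, fun w hw h0 => ?_⟩
      have : w ∈ W ∩ Set.Ioi 0 := ⟨hw, h0⟩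
      rw [hemp] at this
      exact this.elim
    · obtain ⟨w, ⟨hw, hw0⟩, hmin⟩ := Set.exists_min_image (W ∩ Set.Ioi 0) id
        (hWfin.subset Set.inter_subset_left) hne
      exact ⟨w, hw0, fun w' hw' h0 => hmin w' ⟨hw', h0⟩⟩
  have hdist : ∀ g h, ∑ i, ∑ j, ((σ g : Matrix (Fin m) (Fin m) ℝ) i j -
      (σ h : Matrix (Fin m) (Fin m) ℝ) i j) ^ 2 ∈ W := fun g h => by
    refine ⟨((ρ (g * h⁻¹) : Matrix (Fin m) (Fin m) ℝ).trace,
      (ρ (h * g⁻¹) : Matrix (Fin m) (Fin m) ℝ).trace), ⟨⟨g * h⁻¹, rfl⟩, ⟨h * g⁻¹, rfl⟩⟩, ?_⟩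
    have h1 : ∑ i, ∑ j, ((σ g : Matrix (Fin m) (Fin m) ℝ) i j -
        (σ h : Matrix (Fin m) (Fin m) ℝ) i j) ^ 2 =
        (((σ g : Matrix (Fin m) (Fin m) ℝ) - (σ h : Matrix (Fin m) (Fin m) ℝ)) *
          ((σ g : Matrix (Fin m) (Fin m) ℝ) - (σ h : Matrix (Fin m) (Fin m) ℝ))ᵀ).trace := by
      simp [Matrix.trace, Matrix.mul_apply, sq]
    rw [h1, transpose_sub, Matrix.mul_sub, Matrix.sub_mul, Matrix.sub_mul, hinv, hinv, hinv, hinv,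
      mul_inv_cancel, mul_inv_cancel, map_one, trace_sub, trace_sub, trace_sub, Units.val_one,
      trace_one, htr, htr, Fintype.card_fin]
    ring
  -- Sup distance less than `δ` between the entries forces the squared distance below `ε`.
  obtain ⟨δ, hδ, hδε⟩ : ∃ δ > 0, (m : ℝ) * (m * δ ^ 2) < ε := by
    have hc : Filter.Tendsto (fun δ : ℝ => (m : ℝ) * (m * δ ^ 2)) (𝓝[>] 0) (𝓝 0) := by
      have : Continuous fun δ : ℝ => (m : ℝ) * (m * δ ^ 2) := by fun_prop
      simpa using (this.tendsto 0).mono_left nhdsWithin_le_nhds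
    exact ((eventually_mem_nhdsWithin).and (hc.eventually (gt_mem_nhds hε))).exists
  have hfinS : (Set.range fun g => fun i j => (σ g : Matrix (Fin m) (Fin m) ℝ) i j).Finite := by
    refine Set.Finite.of_isBounded_of_separated ?_ hδ ?_
    · refine (Metric.isBounded_closedBall (x := 0) (r := 1)).subset ?_
      rintro _ ⟨g, rfl⟩
      rw [mem_closedBall_zero_iff, pi_norm_le_iff_of_nonneg zero_le_one]
      intro i
      rw [pi_norm_le_iff_of_nonneg zero_le_one]
      exact fun j => Matrix.abs_apply_le_one_of_mul_transpose_eq_one (hσB g) i j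
    · rintro _ ⟨g, rfl⟩ _ ⟨h, rfl⟩ hlt
      by_contra hne
      have hle : ∀ i j, ((σ g : Matrix (Fin m) (Fin m) ℝ) i j -
          (σ h : Matrix (Fin m) (Fin m) ℝ) i j) ^ 2 ≤ δ ^ 2 := fun i j => by
        have := (dist_pi_lt_iff hδ).1 ((dist_pi_lt_iff hδ).1 hlt i) j
        rw [Real.dist_eq] at this
        exact sq_le_sq' (by linarith [neg_abs_le ((σ g : Matrix (Fin m) (Fin m) ℝ) i j -
          (σ h : Matrix (Fin m) (Fin m) ℝ) i j)]) ((le_abs_self _).trans this.le)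
      have hpos : 0 < ∑ i, ∑ j, ((σ g : Matrix (Fin m) (Fin m) ℝ) i j -
          (σ h : Matrix (Fin m) (Fin m) ℝ) i j) ^ 2 := by
        obtain ⟨i, hi⟩ := Function.ne_iff.1 hne
        obtain ⟨j, hj⟩ := Function.ne_iff.1 hi
        refine Finset.sum_pos' (fun i _ => Finset.sum_nonneg fun j _ => sq_nonneg _)
          ⟨i, Finset.mem_univ _, Finset.sum_pos' (fun j _ => sq_nonneg _) ⟨j, Finset.mem_univ _, ?_⟩⟩
        have := sub_ne_zero.2 hj
        positivity
      have h1 := hεW _ (hdist g h) hpos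
      have h2 : ∑ i, ∑ j, ((σ g : Matrix (Fin m) (Fin m) ℝ) i j -
          (σ h : Matrix (Fin m) (Fin m) ℝ) i j) ^ 2 ≤ (m : ℝ) * (m * δ ^ 2) := by
        calc _ ≤ ∑ _i : Fin m, ∑ _j : Fin m, δ ^ 2 :=
              Finset.sum_le_sum fun i _ => Finset.sum_le_sum fun j _ => hle i j
          _ = _ := by simp
      linarith
  refine Set.Finite.of_finite_image (f := fun A : GL (Fin m) ℝ =>
    fun i j => ((B * A * B⁻¹ : GL (Fin m) ℝ) : Matrix (Fin m) (Fin m) ℝ) i j) ?_ ?_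
  · rw [← Set.range_comp]
    exact hfinS
  · intro A _ A' _ h
    have h1 : B * A * B⁻¹ = B * A' * B⁻¹ := Units.ext (Matrix.ext fun i j =>
      congrFun (congrFun h i) j)
    exact mul_left_cancel (mul_right_cancel h1)

/-- A group with property FSI has no nontrivial homomorphism to the positive real numbers. -/
theorem eq_one_of_pos (hΓ : PropertyFSI Γ) (φ : Γ →* ℝ) (hφ : ∀ g, 0 < φ g) (g : Γ) :
    φ g = 1 := by
  have h : ∀ g, φ g ≤ 1 := fun g => by
    have h1 := hΓ.abs_trace_le
      (((Matrix.scalar (Fin 1)).toMonoidHom.comp φ).toHomUnits) g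
    have h2 : |φ g| ≤ 1 := by simpa [Matrix.trace, Matrix.scalar] using h1
    exact (le_abs_self _).trans h2
  refine le_antisymm (h g) ?_
  have h1 : φ g * φ g⁻¹ = 1 := by rw [← map_mul, mul_inv_cancel, map_one]
  have h2 := h g⁻¹
  nlinarith [hφ g, hφ g⁻¹]

end PropertyFSI

/-! ### Representations over local fields -/

namespace BuildingSL

variable {n : ℕ} {K : Type} [NontriviallyNormedField K]

/-- The linear automorphism of `K ^ n` defined by an invertible matrix. -/
def mulVecEquiv (A : GL (Fin n) K) : (Fin n → K) ≃ₗ[K] (Fin n → K) :=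
  { (A : Matrix (Fin n) (Fin n) K).mulVecLin with
    invFun := ((A⁻¹ : GL (Fin n) K) : Matrix (Fin n) (Fin n) K).mulVecLin
    left_inv := fun x => by
      change (A⁻¹).val *ᵥ (A.val *ᵥ x) = x
      rw [mulVec_mulVec, ← Units.val_mul, inv_mul_cancel, Units.val_one, one_mulVec]
    right_inv := fun x => by
      change A.val *ᵥ ((A⁻¹).val *ᵥ x) = x
      rw [mulVec_mulVec, ← Units.val_mul, mul_inv_cancel, Units.val_one, one_mulVec] }

theorem mulVecEquiv_apply (A : GL (Fin n) K) (x : Fin n → K) :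
    mulVecEquiv A x = (A : Matrix (Fin n) (Fin n) K) *ᵥ x := rfl

/-- The factor by which the action of `A` rescales norms, so that their volume remains one. -/
def scale (A : GL (Fin n) K) : ℝ := ‖(A : Matrix (Fin n) (Fin n) K).det‖ ^ ((n : ℝ)⁻¹)

theorem norm_det_pos (A : GL (Fin n) K) : 0 < ‖(A : Matrix (Fin n) (Fin n) K).det‖ :=
  norm_pos_iff.2 ((Matrix.isUnit_iff_isUnit_det _).1 A.isUnit).ne_zero

theorem scale_pos (A : GL (Fin n) K) : 0 < scale A := Real.rpow_pos_of_pos (norm_det_pos A) _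

theorem scale_mul (A B : GL (Fin n) K) : scale (A * B) = scale A * scale B := by
  rw [scale, Units.val_mul, det_mul, norm_mul,
    Real.mul_rpow (norm_det_pos A).le (norm_det_pos B).le]
  rfl

theorem scale_one : scale (1 : GL (Fin n) K) = 1 := by simp [scale]

theorem scale_pow (A : GL (Fin n) K) :
    scale A ^ n = ‖(A : Matrix (Fin n) (Fin n) K).det‖ := by
  obtain rfl | hn := eq_or_ne n 0
  · simp
  · exact Real.rpow_inv_natCast_pow (norm_det_pos A).le hn

theorem isAdaptedBasis_map (A : GL (Fin n) K) {N : (Fin n → K) → ℝ}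
    {b : Module.Basis (Fin n) K (Fin n → K)} (hb : IsAdaptedBasis b N) :
    IsAdaptedBasis (b.map (mulVecEquiv A)) fun x => scale A * N ((mulVecEquiv A).symm x) := by
  intro x
  change scale A * N _ = _
  rw [hb, Real.mul_iSup_of_nonneg (scale_pos A).le]
  refine iSup_congr fun i => ?_
  have h : (mulVecEquiv A).symm (b.map (mulVecEquiv A) i) = b i := by
    rw [Module.Basis.map_apply, LinearEquiv.symm_apply_apply]
  change _ = ‖b.repr ((mulVecEquiv A).symm x) i‖ *
    (scale A * N ((mulVecEquiv A).symm (b.map (mulVecEquiv A) i)))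
  rw [h]
  ring

/-- The action of `GL(n)` on the building: a matrix transports norms, which are then rescaled to
have volume one. -/
def act (A : GL (Fin n) K) (N : BuildingSL n K) : BuildingSL n K where
  norm x := scale A * N.norm ((mulVecEquiv A).symm x)
  isUltrametricNorm :=
    { eq_zero_iff := fun x => by
        rw [mul_eq_zero, or_iff_right (scale_pos A).ne', N.isUltrametricNorm.eq_zero_iff,
          LinearEquiv.map_eq_zero_iff]
      smul := fun c x => by
        rw [map_smul, N.isUltrametricNorm.smul]
        ring
      add_le_max := fun x y => by
        rw [map_add, ← mul_max_of_nonneg _ _ (scale_pos A).le]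
        exact mul_le_mul_of_nonneg_left (N.isUltrametricNorm.add_le_max _ _) (scale_pos A).le }
  exists_isAdaptedBasis := by
    obtain ⟨b, hb, hvol⟩ := N.exists_isAdaptedBasis
    refine ⟨b.map (mulVecEquiv A), isAdaptedBasis_map A hb, ?_⟩
    have h1 : (Pi.basisFun K (Fin n)).det (b.map (mulVecEquiv A)) =
        (A : Matrix (Fin n) (Fin n) K).det * (Pi.basisFun K (Fin n)).det b := by
      have h2 : (b.map (mulVecEquiv A) : Fin n → Fin n → K) =
          Matrix.toLin' (A : Matrix (Fin n) (Fin n) K) ∘ b := by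
        ext i
        simp [mulVecEquiv_apply]
      rw [h2, Module.Basis.det_comp, LinearMap.det_toLin']
    rw [h1, norm_mul, ← hvol, ← scale_pow]
    simp only [Module.Basis.map_apply, LinearEquiv.symm_apply_apply]
    rw [Finset.prod_mul_distrib, Finset.prod_const, Finset.card_univ, Fintype.card_fin]

theorem act_norm (A : GL (Fin n) K) (N : BuildingSL n K) (x : Fin n → K) :
    (act A N).norm x = scale A * N.norm ((A⁻¹ : GL (Fin n) K).val *ᵥ x) := rfl

theorem act_one (N : BuildingSL n K) : act 1 N = N := by
  ext x
  rw [act_norm, scale_one, inv_one, Units.val_one, one_mulVec, one_mul]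

theorem act_mul (A B : GL (Fin n) K) (N : BuildingSL n K) : act (A * B) N = act A (act B N) := by
  ext x
  rw [act_norm, act_norm, act_norm, scale_mul, _root_.mul_inv_rev, Units.val_mul, ← mulVec_mulVec,
    mul_assoc]

/-- The action of `GL(n)` on the building, as a homomorphism. -/
def actHom : GL (Fin n) K →* Equiv.Perm (BuildingSL n K) where
  toFun A :=
    { toFun := act A
      invFun := act A⁻¹
      left_inv := fun N => by rw [← act_mul, inv_mul_cancel, act_one]
      right_inv := fun N => by rw [← act_mul, mul_inv_cancel, act_one] }
  map_one' := Equiv.ext act_one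
  map_mul' A B := Equiv.ext (act_mul A B)

theorem distance_act (A : GL (Fin n) K) (N N' : BuildingSL n K) :
    distance (act A N) (act A N') = distance N N' := by
  have key : ∀ (A : GL (Fin n) K) (N N' : BuildingSL n K),
      {r : ℝ | ∃ b : Module.Basis (Fin n) K (Fin n → K), IsAdaptedBasis b N.norm ∧
        IsAdaptedBasis b N'.norm ∧ r = √(∑ i, Real.log (N'.norm (b i) / N.norm (b i)) ^ 2)} ⊆
      {r : ℝ | ∃ b : Module.Basis (Fin n) K (Fin n → K), IsAdaptedBasis b (act A N).norm ∧
        IsAdaptedBasis b (act A N').norm ∧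
        r = √(∑ i, Real.log ((act A N').norm (b i) / (act A N).norm (b i)) ^ 2)} := by
    rintro A N N' r ⟨b, hb, hb', rfl⟩
    refine ⟨b.map (mulVecEquiv A), isAdaptedBasis_map A hb, isAdaptedBasis_map A hb', ?_⟩
    have h : ∀ (M : BuildingSL n K) i,
        (act A M).norm (b.map (mulVecEquiv A) i) = scale A * M.norm (b i) := fun M i => by
      change scale A * M.norm ((mulVecEquiv A).symm _) = _
      rw [Module.Basis.map_apply, LinearEquiv.symm_apply_apply]
    simp only [h, mul_div_mul_left _ _ (scale_pos A).ne']
  have h1 := key A⁻¹ (act A N) (act A N')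
  rw [← act_mul, ← act_mul, inv_mul_cancel, act_one, act_one] at h1
  exact congrArg sInf (h1.antisymm (key A N N'))

end BuildingSL

/-- Over a local field, the traces of a representation of a group with property FSI are integers,
because the representation preserves an ultrametric norm with an adapted basis. -/
theorem PropertyFSI.norm_trace_le_one {Γ : Type*} [Group Γ] (hΓ : PropertyFSI Γ) {n : ℕ}
    {K : Type} [NontriviallyNormedField K] [IsUltrametricDist K] [LocallyCompactSpace K]
    (ρ : Γ →* GL (Fin n) K) (g : Γ) : ‖(ρ g : Matrix (Fin n) (Fin n) K).trace‖ ≤ 1 := by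
  obtain ⟨N, hN⟩ := hΓ.2 n K (BuildingSL.actHom.comp ρ)
    fun g N N' => BuildingSL.distance_act (ρ g) N N'
  have hdet : ∀ g, ‖(ρ g : Matrix (Fin n) (Fin n) K).det‖ = 1 :=
    hΓ.eq_one_of_pos
      { toFun := fun g => ‖(ρ g : Matrix (Fin n) (Fin n) K).det‖
        map_one' := by simp
        map_mul' := fun g h => by simp }
      fun g => BuildingSL.norm_det_pos (ρ g)
  have hpres : ∀ x, N.norm ((ρ g : Matrix (Fin n) (Fin n) K) *ᵥ x) = N.norm x := fun x => by
    have h1 : BuildingSL.act (ρ g⁻¹) N = N := hN g⁻¹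
    have h2 := congrArg (fun M => M.norm x) h1
    simp only [BuildingSL.act_norm, BuildingSL.scale, hdet, Real.one_rpow, one_mul] at h2
    rwa [map_inv, inv_inv] at h2
  obtain ⟨b, hb, -⟩ := N.exists_isAdaptedBasis
  have htr : (ρ g : Matrix (Fin n) (Fin n) K).trace =
      ∑ i, b.repr ((ρ g : Matrix (Fin n) (Fin n) K) *ᵥ b i) i := by
    rw [← Matrix.trace_toLin'_eq, LinearMap.trace_eq_matrix_trace K b, Matrix.trace]
    simp [LinearMap.toMatrix_apply]
  rw [htr]
  refine IsUltrametricDist.norm_sum_le_of_forall_le_of_nonneg zero_le_one fun i _ => ?_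
  have hpos : 0 < N.norm (b i) := by
    have hne : N.norm (b i) ≠ 0 := fun h =>
      b.ne_zero i ((N.isUltrametricNorm.eq_zero_iff _).1 h)
    refine lt_of_le_of_ne ?_ hne.symm
    have h0 : N.norm 0 = 0 := (N.isUltrametricNorm.eq_zero_iff _).2 rfl
    have hneg : N.norm (-b i) = N.norm (b i) := by
      rw [← neg_one_smul K, N.isUltrametricNorm.smul]
      simp
    have := N.isUltrametricNorm.add_le_max (b i) (-b i)
    rwa [add_neg_cancel, h0, hneg, max_self] at this
  have h1 : ‖b.repr ((ρ g : Matrix (Fin n) (Fin n) K) *ᵥ b i) i‖ * N.norm (b i) ≤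
      N.norm (b i) := by
    conv_rhs => rw [← hpres (b i), hb]
    exact le_ciSup (f := fun j => ‖b.repr ((ρ g : Matrix (Fin n) (Fin n) K) *ᵥ b i) j‖ *
      N.norm (b j)) (Set.finite_range _).bddAbove i
  exact le_of_mul_le_mul_right (by rwa [one_mul]) hpos

/-! ### Rational representations -/

/-- A rational number that is integral at all primes is an integer. -/
theorem Rat.den_eq_one_of_forall_norm_le_one {t : ℚ}
    (h : ∀ (p : ℕ) [Fact p.Prime], ‖(t : ℚ_[p])‖ ≤ 1) : t.den = 1 := by
  by_contra hden
  obtain ⟨p, hp, hpd⟩ := Nat.exists_prime_and_dvd hden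
  have : Fact p.Prime := ⟨hp⟩
  have h1 : ‖((t.den : ℤ) : ℚ_[p])‖ < 1 :=
    Padic.norm_intCast_lt_one_iff.2 (Int.natCast_dvd_natCast.2 hpd)
  have h2 : (t : ℚ_[p]) * ((t.den : ℤ) : ℚ_[p]) = ((t.num : ℤ) : ℚ_[p]) := by
    have := Rat.mul_den_eq_num t
    exact_mod_cast congrArg (fun q : ℚ => (q : ℚ_[p])) this
  have h3 : ‖((t.num : ℤ) : ℚ_[p])‖ < 1 := by
    rw [← h2, norm_mul]
    exact lt_of_le_of_lt (mul_le_of_le_one_left (norm_nonneg _) (h p)) h1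
  have h4 : p ∣ t.num.natAbs := Int.natCast_dvd.1 (Padic.norm_intCast_lt_one_iff.1 h3)
  exact hp.one_lt.ne' (Nat.dvd_one.1 (t.reduced ▸ Nat.dvd_gcd h4 hpd))

theorem Matrix.GeneralLinearGroup.trace_map {m : ℕ} {R S : Type*} [CommRing R] [CommRing S]
    (f : R →+* S) (A : GL (Fin m) R) :
    (GeneralLinearGroup.map f A : Matrix (Fin m) (Fin m) S).trace =
      f (A : Matrix (Fin m) (Fin m) R).trace := by
  simp [Matrix.trace]

/-- Rational representations of a group with property FSI have finite image: their traces are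
integers, because of the buildings, and bounded, because of the symmetric spaces. -/
theorem PropertyFSI.finite_range_rat {Γ : Type*} [Group Γ] (hΓ : PropertyFSI Γ) {m : ℕ}
    (ρ : Γ →* GL (Fin m) ℚ) : (Set.range ρ).Finite := by
  let ι : GL (Fin m) ℚ →* GL (Fin m) ℝ := GeneralLinearGroup.map (algebraMap ℚ ℝ)
  have hι : Function.Injective ι := fun A B h =>
    Units.ext (Matrix.map_injective (algebraMap ℚ ℝ).injective (congrArg Units.val h))
  have hint : ∀ g, ((ρ g : Matrix (Fin m) (Fin m) ℚ).trace).den = 1 := fun g =>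
    Rat.den_eq_one_of_forall_norm_le_one fun p hp => by
      have := hΓ.norm_trace_le_one ((GeneralLinearGroup.map (algebraMap ℚ ℚ_[p])).comp ρ) g
      rwa [MonoidHom.comp_apply, GeneralLinearGroup.trace_map, eq_ratCast] at this
  have hfin : (Set.range fun g => ((ι.comp ρ) g : Matrix (Fin m) (Fin m) ℝ).trace).Finite := by
    refine ((Set.finite_Icc (-(m : ℤ)) m).image (Int.cast : ℤ → ℝ)).subset ?_
    rintro _ ⟨g, rfl⟩
    have h1 := hΓ.abs_trace_le (ι.comp ρ) g
    have h2 : ((ι.comp ρ) g : Matrix (Fin m) (Fin m) ℝ).trace =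
        (((ρ g : Matrix (Fin m) (Fin m) ℚ).trace.num : ℤ) : ℝ) := by
      rw [MonoidHom.comp_apply, GeneralLinearGroup.trace_map, eq_ratCast]
      exact_mod_cast congrArg (Rat.cast : ℚ → ℝ) (Rat.coe_int_num_of_den_eq_one (hint g)).symm
    refine ⟨(ρ g : Matrix (Fin m) (Fin m) ℚ).trace.num, ?_, h2.symm⟩
    rw [h2, abs_le] at h1
    exact ⟨by exact_mod_cast h1.1, by exact_mod_cast h1.2⟩
  have := hΓ.finite_range_of_finite_trace (ι.comp ρ) hfin
  rw [MonoidHom.coe_comp, Set.range_comp] at this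
  exact this.of_finite_image hι.injOn

/-! ### Restriction of scalars -/

section RestrictScalars

variable (k F : Type*) [Field k] [Field F] [Algebra k F] [FiniteDimensional k F] (n : ℕ)

/-- Restriction of scalars of matrices along a finite field extension. -/
def Matrix.restrictScalarsHom : Matrix (Fin n) (Fin n) F →+*
    Matrix (Fin (n * Module.finrank k F)) (Fin (n * Module.finrank k F)) k :=
  ((Matrix.reindexRingEquiv k finProdFinEquiv).toRingHom.comp
    (Matrix.compRingEquiv (Fin n) (Fin (Module.finrank k F)) k).toRingHom).comp
      (Algebra.leftMulMatrix (Module.finBasis k F)).toRingHom.mapMatrix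

theorem Matrix.restrictScalarsHom_injective :
    Function.Injective (Matrix.restrictScalarsHom k F n) :=
  ((Matrix.reindexRingEquiv k finProdFinEquiv).injective.comp
    (Matrix.compRingEquiv (Fin n) (Fin (Module.finrank k F)) k).injective).comp
      (Matrix.map_injective (Algebra.leftMulMatrix_injective (Module.finBasis k F)))

theorem Matrix.trace_restrictScalarsHom (A : Matrix (Fin n) (Fin n) F) :
    (Matrix.restrictScalarsHom k F n A).trace = Algebra.trace k F A.trace := by
  simp only [Matrix.trace, map_sum, Algebra.trace_eq_matrix_trace (Module.finBasis k F)]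
  rw [← finProdFinEquiv.sum_comp, Fintype.sum_prod_type]
  rw [Finset.sum_comm]
  simp [Matrix.restrictScalarsHom, Matrix.sum_apply]

/-- Restriction of scalars of invertible matrices along a finite field extension. -/
def Matrix.GeneralLinearGroup.restrictScalars : GL (Fin n) F →*
    GL (Fin (n * Module.finrank k F)) k :=
  Units.map (Matrix.restrictScalarsHom k F n : Matrix (Fin n) (Fin n) F →* _)

theorem Matrix.GeneralLinearGroup.restrictScalars_injective :
    Function.Injective (Matrix.GeneralLinearGroup.restrictScalars k F n) :=
  Units.map_injective (Matrix.restrictScalarsHom_injective k F n)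

theorem Matrix.GeneralLinearGroup.trace_restrictScalars (A : GL (Fin n) F) :
    (Matrix.GeneralLinearGroup.restrictScalars k F n A).val.trace =
      Algebra.trace k F (A : Matrix (Fin n) (Fin n) F).trace :=
  Matrix.trace_restrictScalarsHom k F n _

end RestrictScalars

/-! ### Traces of complex representations are algebraic -/

/-- An embedding into an algebraically closed field extends to algebraic extensions. -/
theorem IsAlgClosed.exists_ringHom_extension {S E L : Type*} [CommRing S] [Field E] [Algebra S E]
    [FaithfulSMul S E] [Algebra.IsAlgebraic S E] [Field L] [IsAlgClosed L] (f : S →+* L)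
    (hf : Function.Injective f) : ∃ σ : E →+* L, ∀ x, σ (algebraMap S E x) = f x := by
  let _ : Algebra S L := f.toAlgebra
  have : IsDomain S := hf.isDomain f
  have : FaithfulSMul S L := (faithfulSMul_iff_algebraMap_injective S L).2 hf
  have : Module.IsTorsionFree S L := inferInstance
  let σ : E →ₐ[S] L := IsAlgClosed.lift
  exact ⟨σ, fun x => σ.commutes x⟩

/-- A transcendental number can be translated by any integer by an endomorphism of `ℂ`: extend the
number to a transcendence basis, translate it in the polynomial ring, and extend the resulting
embedding to the algebraic extension `ℂ`. -/
theorem Transcendental.exists_ringHom_eq_add {t : ℂ} (ht : Transcendental ℚ t) (c : ℚ) :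
    ∃ σ : ℂ →+* ℂ, σ t = t + c := by
  obtain ⟨s, hts, hs⟩ := exists_isTranscendenceBasis_superset (R := ℚ) (A := ℂ) (s := {t})
    ((algebraicIndependent_singleton_iff (⟨t, rfl⟩ : ({t} : Set ℂ))).2 ht)
  -- Translation of all variables by `c`.
  let τ : MvPolynomial s ℚ →ₐ[ℚ] MvPolynomial s ℚ :=
    MvPolynomial.aeval fun i => MvPolynomial.X i + MvPolynomial.C c
  let τ' : MvPolynomial s ℚ →ₐ[ℚ] MvPolynomial s ℚ :=
    MvPolynomial.aeval fun i => MvPolynomial.X i - MvPolynomial.C c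
  have hτ : Function.LeftInverse τ' τ := fun p => by
    have : τ'.comp τ = AlgHom.id ℚ _ := by
      ext1 i
      simp [τ, τ', MvPolynomial.algebraMap_eq]
    exact DFunLike.congr_fun this p
  let S := Algebra.adjoin ℚ (Set.range ((↑) : s → ℂ))
  let f : S →ₐ[ℚ] ℂ := ((MvPolynomial.aeval ((↑) : s → ℂ)).comp τ).comp hs.1.aevalEquiv.symm
  have hf : Function.Injective f :=
    ((show Function.Injective _ from hs.1).comp hτ.injective).comp hs.1.aevalEquiv.symm.injective
  have : Algebra.IsAlgebraic S ℂ := hs.isAlgebraic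
  let t' : S := ⟨t, Algebra.subset_adjoin ⟨⟨t, hts rfl⟩, rfl⟩⟩
  have ht' : f t' = t + c := by
    have h1 : hs.1.aevalEquiv.symm t' = MvPolynomial.X ⟨t, hts rfl⟩ := by
      rw [AlgEquiv.symm_apply_eq]
      ext
      simp [t']
    simp [f, h1, τ]
  obtain ⟨σ, hσ⟩ := IsAlgClosed.exists_ringHom_extension (E := ℂ) f.toRingHom hf
  exact ⟨σ, (hσ t').trans ht'⟩

/-- A transcendental trace could be translated far away by an endomorphism `σ` of `ℂ`, although the
real representation underlying `σ ∘ ρ` has bounded traces. -/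
theorem PropertyFSI.isAlgebraic_trace {Γ : Type*} [Group Γ] (hΓ : PropertyFSI Γ) {n : ℕ}
    (ρ : Γ →* GL (Fin n) ℂ) (g : Γ) : IsAlgebraic ℚ (ρ g : Matrix (Fin n) (Fin n) ℂ).trace := by
  have hbound : ∀ σ : ℂ →+* ℂ,
      |2 * (σ (ρ g : Matrix (Fin n) (Fin n) ℂ).trace).re| ≤ n * 2 := fun σ => by
    have := hΓ.abs_trace_le
      ((GeneralLinearGroup.restrictScalars ℝ ℂ n).comp ((GeneralLinearGroup.map σ).comp ρ)) g
    rw [MonoidHom.comp_apply, GeneralLinearGroup.trace_restrictScalars, MonoidHom.comp_apply,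
      GeneralLinearGroup.trace_map, Algebra.trace_complex_apply] at this
    simpa using this
  by_contra htr
  obtain ⟨k, hk⟩ := exists_nat_gt (2 * n : ℝ)
  obtain ⟨σ, hσ⟩ := Transcendental.exists_ringHom_eq_add htr k
  have h1 := abs_le.1 (hbound (RingHom.id ℂ))
  have h2 := abs_le.1 (hbound σ)
  rw [hσ] at h2
  simp only [RingHom.id_apply, Complex.add_re, Rat.cast_natCast, Complex.natCast_re] at h1 h2
  linarith

/-! ### Complex representations -/

/-- Reduction modulo a maximal ideal is injective on algebraic elements: a non-zero element that is
algebraic over the base field is a unit. -/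
theorem Ideal.Quotient.mk_injOn_isAlgebraic {k A : Type*} [Field k] [CommRing A] [IsDomain A]
    [Algebra k A] (I : Ideal A) (hI : I ≠ ⊤) :
    Set.InjOn (Ideal.Quotient.mk I) {x | IsAlgebraic k x} := by
  intro x hx y hy hxy
  by_contra hne
  have hmem : x - y ∈ I := Ideal.Quotient.eq.1 hxy
  have halg : IsAlgebraic k (x - y) := hx.sub hy
  obtain ⟨r, hr, h⟩ := halg.exists_nonzero_dvd (mem_nonZeroDivisors_of_ne_zero (sub_ne_zero.2 hne))
  exact hI (I.eq_top_of_isUnit_mem (I.mem_of_dvd h hmem)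
    ((IsUnit.mk0 r hr).map (algebraMap k A)))

/-- A finite-dimensional representation of a finitely generated group is defined over a finitely
generated algebra, namely the one generated by the entries of the matrices of the generators and of
their inverses. -/
theorem MonoidHom.exists_fg_subalgebra_map_eq {Γ : Type*} [Group Γ] [Group.FG Γ] (k : Type*)
    {F : Type*} [Field k] [Field F] [Algebra k F] {n : ℕ} (ρ : Γ →* GL (Fin n) F) :
    ∃ (A : Subalgebra k F) (ρA : Γ →* GL (Fin n) A), A.FG ∧
      ∀ g, GeneralLinearGroup.map (A.val : A →+* F) (ρA g) = ρ g := by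
  obtain ⟨S, hS⟩ := Group.fg_def.1 ‹Group.FG Γ›
  let T : Set F := ⋃ s ∈ S, Set.range (fun ij : Fin n × Fin n => (ρ s).val ij.1 ij.2) ∪
    Set.range (fun ij : Fin n × Fin n => (ρ s⁻¹).val ij.1 ij.2)
  have hT : T.Finite := S.finite_toSet.biUnion fun s _ =>
    (Set.finite_range _).union (Set.finite_range _)
  let A := Algebra.adjoin k T
  have hA : ∀ g, (∀ i j, (ρ g).val i j ∈ A) ∧ ∀ i j, (ρ g⁻¹).val i j ∈ A := fun g => by
    have hmul : ∀ g h, (∀ i j, (ρ g).val i j ∈ A) → (∀ i j, (ρ h).val i j ∈ A) →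
        ∀ i j, (ρ (g * h)).val i j ∈ A := fun g h hg hh i j => by
      rw [map_mul, Units.val_mul, Matrix.mul_apply]
      exact sum_mem fun l _ => mul_mem (hg i l) (hh l j)
    have hg : g ∈ Subgroup.closure (S : Set Γ) := hS ▸ Subgroup.mem_top g
    induction hg using Subgroup.closure_induction with
    | mem s hs =>
      exact ⟨fun i j => Algebra.subset_adjoin (Set.mem_biUnion hs (Or.inl ⟨(i, j), rfl⟩)),
        fun i j => Algebra.subset_adjoin (Set.mem_biUnion hs (Or.inr ⟨(i, j), rfl⟩))⟩
    | one =>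
      have h1 : ∀ i j, (ρ 1).val i j ∈ A := fun i j => by
        rw [map_one, Units.val_one, Matrix.one_apply]
        split_ifs
        exacts [one_mem A, zero_mem A]
      exact ⟨h1, by rwa [inv_one]⟩
    | mul g h _ _ hg hh =>
      exact ⟨hmul g h hg.1 hh.1, by rw [_root_.mul_inv_rev]; exact hmul _ _ hh.2 hg.2⟩
    | inv g _ hg => exact ⟨hg.2, by rw [inv_inv]; exact hg.1⟩
  let ρA : Γ →* GL (Fin n) A := MonoidHom.toHomUnits
    { toFun := fun g => Matrix.of fun i j => ⟨(ρ g).val i j, (hA g).1 i j⟩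
      map_one' := by
        ext i j
        simp [Matrix.one_apply, apply_ite]
      map_mul' := fun g h => by
        ext i j
        simp [Matrix.mul_apply] }
  exact ⟨A, ρA, ⟨hT.toFinset, by simp [A]⟩, fun g => Units.ext rfl⟩

/-- Complex representations of a finitely generated group with property FSI have finite image: the
representation specialises to a number field, where the image is finite, and the traces, being
algebraic, can be recovered from the specialisation. -/
theorem PropertyFSI.finite_range_complex {Γ : Type*} [Group Γ] [Group.FG Γ] (hΓ : PropertyFSI Γ)
    {n : ℕ} (ρ : Γ →* GL (Fin n) ℂ) : (Set.range ρ).Finite := by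
  obtain ⟨A, ρA, hAfg, hρA⟩ := ρ.exists_fg_subalgebra_map_eq ℚ
  have : Algebra.FiniteType ℚ A := (Subalgebra.fg_iff_finiteType _).1 hAfg
  obtain ⟨M, hM⟩ := Ideal.exists_maximal A
  -- Zariski's lemma: the residue field is a number field.
  let _ : Field (A ⧸ M) := Ideal.Quotient.field M
  have : Module.Finite ℚ (A ⧸ M) := finite_of_finite_type_of_isJacobsonRing ℚ (A ⧸ M)
  let ρM : Γ →* GL (Fin n) (A ⧸ M) := (GeneralLinearGroup.map (Ideal.Quotient.mk M)).comp ρA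
  have hρM : (Set.range ρM).Finite := by
    have := hΓ.finite_range_rat ((GeneralLinearGroup.restrictScalars ℚ (A ⧸ M) n).comp ρM)
    rw [MonoidHom.coe_comp, Set.range_comp] at this
    exact this.of_finite_image (GeneralLinearGroup.restrictScalars_injective ℚ (A ⧸ M) n).injOn
  have htr : ∀ g, (((ρA g).val.trace : A) : ℂ) = (ρ g).val.trace := fun g => by
    rw [← hρA g]
    exact (GeneralLinearGroup.trace_map (A.val : A →+* ℂ) (ρA g)).symm
  have hfinA : (Set.range fun g => (ρA g).val.trace).Finite := by
    refine Set.Finite.of_finite_image (f := Ideal.Quotient.mk M) ?_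
      ((Ideal.Quotient.mk_injOn_isAlgebraic (k := ℚ) M hM.ne_top).mono ?_)
    · refine (hρM.image fun B => B.val.trace).subset ?_
      rintro _ ⟨_, ⟨g, rfl⟩, rfl⟩
      exact ⟨ρM g, ⟨g, rfl⟩, GeneralLinearGroup.trace_map _ _⟩
    · rintro _ ⟨g, rfl⟩
      exact (isAlgebraic_algebraMap_iff (R := ℚ) (A := ℂ) (a := (ρA g).val.trace)
        Subtype.val_injective).1 (by
          change IsAlgebraic ℚ (((ρA g).val.trace : A) : ℂ)
          rw [htr]
          exact hΓ.isAlgebraic_trace ρ g)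
  have hfin := hΓ.finite_range_of_finite_trace
    ((GeneralLinearGroup.restrictScalars ℝ ℂ n).comp ρ) (by
      refine (hfinA.image fun a : A => Algebra.trace ℝ ℂ a).subset ?_
      rintro _ ⟨g, rfl⟩
      refine ⟨_, ⟨g, rfl⟩, ?_⟩
      change Algebra.trace ℝ ℂ (((ρA g).val.trace : A) : ℂ) = _
      rw [htr]
      exact (GeneralLinearGroup.trace_restrictScalars ℝ ℂ n (ρ g)).symm)
  rw [MonoidHom.coe_comp, Set.range_comp] at hfin
  exact hfin.of_finite_image (GeneralLinearGroup.restrictScalars_injective ℝ ℂ n).injOn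

end

theorem proposition2p2 (Γ : Type*) [Group Γ] [Group.FG Γ] (hΓ : PropertyFSI Γ) :
    FiniteRepresentationType Γ :=
  fun _ ρ => hΓ.finite_range_complex ρ
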